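/- \textbf{Setting.} Let $K$ be a field that is complete for a discrete valuation $\mathrm{val}:K\to\mathbb R\cup\{\infty\}$ (nontrivial, with a uniformizer), let $n\ge 1$, $r\in\mathbb Q^n$, and let $K\{X;r\}$ be the ring of Laurent series $\sum_{u\in\mathbb Z^n}a_uX^u$ with $a_u\in K$ and $\mathrm{val}(a_u)-r\cdot u\to+\infty$ as $|u|\to\infty$. Put $\mathrm{val}_r(\sum_u a_uX^u)=\min_u(\mathrm{val}(a_u)-r\cdot u)$. Let $T=\{X^u: u\in\mathbb Z^n\}$. Let $(T_i)_{i\in I}$ be a conic decomposition of $T$: a finite family of finitely generated submonoids of $T$ with union $T$, each having $1$ as its only invertible element and generating the group $T$. Let $\le$ be a generalized monomial order (g.m.o.) for it: a total order on $T$ such that $1\le t$ for all $t\in T$, and such that $\rho<s$ implies $\rho t<st$ whenever $\rho\in T$, $i\in I$ and $s,t\in T_i$. The preorder $\le_r$ on terms $aX^u$ ($a\in K^\times$) is given by: $aX^u\le_r bX^v$ iff $\mathrm{val}_r(aX^u)>\mathrm{val}_r(bX^v)$, or $\mathrm{val}_r(aX^u)=\mathrm{val}_r(bX^v)$ and $X^u\le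 X^v$. \textbf{Leading data.} For a nonzero Laurent polynomial $p$, $\mathrm{lm}(p)$ is its largest monomial, $T_i(p)=\{t\in T:\mathrm{lm}(tp)\in T_i\}$ and $\mathrm{lm}_i(p)=\mathrm{lm}(tp)t^{-1}$ for any $t\in T_i(p)$. For a nonzero $f\in K\{X;r\}$, let $\mathrm{in}_r(f)$ be the sum of the terms of $f$ of valuation $\mathrm{val}_r(f)$; put $\mathrm{lm}(f)=\mathrm{lm}(\mathrm{in}_r(f))$, $T_i(f)=T_i(\mathrm{in}_r(f))$, $\mathrm{lm}_i(f)=\mathrm{lm}_i(\mathrm{in}_r(f))$, let $\mathrm{lc}(f)$, $\mathrm{lc}_i(f)$ be the coefficients of $\mathrm{lm}(f)$, $\mathrm{lm}_i(f)$ in $f$, and let $\mathrm{lt}(f)=\mathrm{lc}(f)\mathrm{lm}(f)$, $\mathrm{lt}_i(f)=\mathrm{lc}_i(f)\mathrm{lm}_i(f)$. (So $\mathrm{lt}(f)$ is the largest term of $f$ for $\le_r$.) \textbf{Gröbner bases.} A finite subset $G\subseteq J\setminus\{0\}$ of an ideal $J$ of $K\{X;r\}$ is a Gröbner basis of $J$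 if $\{\mathrm{lm}(f): f\in J,\ f\ne 0\}=\bigcup_{g\in G,\,i\in I}\mathrm{lm}_i(g)T_i(g)$. \textbf{Division.} Division of $f$ by a family $(h_1,\dots,h_m)$ of nonzero elements starts with dividend $f$, quotients $q_1=\dots=q_m=0$ and remainder $s=0$. As long as the current dividend $f$ is nonzero: if there are $i\in I$ and $j$ with $\mathrm{lm}\bigl(\tfrac{\mathrm{lm}(f)}{\mathrm{lm}_i(h_j)}h_j\bigr)=\mathrm{lm}(f)$, choose such a pair, put $t=\mathrm{lt}(f)/\mathrm{lt}_i(h_j)$, and replace $q_j$ by $q_j+t$ and $f$ by $f-th_j$; otherwise replace $s$ by $s+\mathrm{lt}(f)$ and $f$ by $f-\mathrm{lt}(f)$. The execution may be infinite; the output is the limit (for $\mathrm{val}_r$) of the $q_j$ and of $s$, and the limit of $s$ is called a remainder of $f$ modulo $(h_1,\dots,h_m)$. It may depend on the choices made. \textbf{S-pairs.} For $v\in\mathrm{lm}_i(f)T_i(f)\cap\mathrm{lm}_i(g)T_i(g)$ put $S(i,f,g,v)=\mathrm{lc}_i(g)\frac{v}{\mathrm{lm}_i(f)}f-\mathrm{lc}_i(f)\frac{v}{\mathrm{lm}_i(g)}g$.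 \textbf{Proposition (Buchberger criterion).} Let $H=(h_1,\dots,h_m)$ be a finite family of nonzero elements of $K\{X;r\}$ and let $J$ be the ideal generated by $H$. For each $i\in I$ and all $h_j\ne h_k$, let $U(i,h_j,h_k)$ be a finite set of generators of the $T_i$-module $\mathrm{lm}_i(h_j)T_i(h_j)\cap\mathrm{lm}_i(h_k)T_i(h_k)$. The following are equivalent: (1) $H$ is a Gröbner basis of $J$; (2) for all $i\in I$, $h_j\ne h_k$ and $v\in U(i,h_j,h_k)$, every remainder of $S(i,h_j,h_k,v)$ modulo $H$ is $0$; (3) for all $i\in I$, $h_j\ne h_k$ and $v\in U(i,h_j,h_k)$, $0$ is a remainder of $S(i,h_j,h_k,v)$ modulo $H$. -/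

import Mathlib

open scoped Topology

namespace LaurentGB

noncomputable section

/-! ### The valued field and the monomials

`K` is a field with a complete non-archimedean absolute value; the valuation is
`val x = - log ‖x‖`, with `val 0 = ∞`. Monomials `X^u` are represented by their exponents
`u : Fin n → ℤ`, so that the group `T` of all monomials is `Fin n → ℤ`, written additively. -/

/-- The real valuation attached to the absolute value of `K`. -/
def val {K : Type*} [NormedField K] (a : K) : WithTop ℝ :=
  open Classical in if a = 0 then ⊤ else ((-Real.log ‖a‖ : ℝ) : WithTop ℝ)

/-- The valuation of `K` is discrete: the maximal ideal `{x | 0 < val x}` of the valuation ring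
`{x | 0 ≤ val x}` is generated by a nonzero element (a uniformizer). -/
def IsDiscretelyValued (K : Type*) [NormedField K] : Prop :=
  ∃ ϖ : K, ϖ ≠ 0 ∧ 0 < val ϖ ∧ ∀ x : K, 0 < val x → ∃ y : K, 0 ≤ val y ∧ x = y * ϖ

/-- The scalar product `r · u`. -/
def dot {n : ℕ} (r : Fin n → ℚ) (u : Fin n → ℤ) : ℝ := ∑ k, (r k : ℝ) * (u k : ℝ)

/-- `val_r (a X^u) = val a - r · u`. -/
def termVal {K : Type*} [NormedField K] {n : ℕ} (r : Fin n → ℚ) (a : K) (u : Fin n → ℤ) :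
    WithTop ℝ :=
  val a + ((-dot r u : ℝ) : WithTop ℝ)

/-- The family of coefficients `c` satisfies `val (c u) - r · u → +∞` as `|u| → ∞`. -/
def Converges {K : Type*} [NormedField K] {n : ℕ} (r : Fin n → ℚ) (c : (Fin n → ℤ) → K) : Prop :=
  ∀ B : ℝ, {u | termVal r (c u) u < (B : WithTop ℝ)}.Finite

theorem termVal_zero {K : Type*} [NormedField K] {n : ℕ} (r : Fin n → ℚ) (u : Fin n → ℤ) :
    termVal r (0 : K) u = ⊤ := by
  simp [termVal, val]

theorem termVal_lt_iff {K : Type*} [NormedField K] {n : ℕ} (r : Fin n → ℚ) (a : K)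
    (u : Fin n → ℤ) (B : ℝ) :
    termVal r a u < (B : WithTop ℝ) ↔ Real.exp (-B) < ‖a‖ * Real.exp (dot r u) := by
  by_cases ha : a = 0
  · subst ha
    simp [termVal_zero, Real.exp_nonneg]
  · have hpos : 0 < ‖a‖ := norm_pos_iff.mpr ha
    rw [termVal, val, if_neg ha, ← WithTop.coe_add, WithTop.coe_lt_coe,
      show ‖a‖ * Real.exp (dot r u) = Real.exp (Real.log ‖a‖ + dot r u) by
        rw [Real.exp_add, Real.exp_log hpos], Real.exp_lt_exp]
    constructor <;> intro h <;> linarith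

theorem converges_iff {K : Type*} [NormedField K] {n : ℕ} (r : Fin n → ℚ)
    (c : (Fin n → ℤ) → K) :
    Converges r c ↔
      Filter.Tendsto (fun u => ‖c u‖ * Real.exp (dot r u)) Filter.cofinite (𝓝 0) := by
  constructor
  · intro h
    rw [Metric.tendsto_nhds]
    intro ε hε
    have h2 := h (-Real.log (ε / 2))
    rw [Filter.eventually_cofinite]
    refine h2.subset fun u hu => ?_
    rw [Set.mem_ofPred_eq, termVal_lt_iff, neg_neg, Real.exp_log (by positivity)]
    rw [Set.mem_ofPred_eq, Real.dist_eq, sub_zero, abs_of_nonneg (by positivity), not_lt] at hu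
    linarith
  · intro h B
    have h2 := h.eventually (gt_mem_nhds (Real.exp_pos (-B)))
    rw [Filter.eventually_cofinite] at h2
    refine h2.subset fun u hu => ?_
    rw [Set.mem_ofPred_eq, termVal_lt_iff] at hu
    exact not_lt.mpr hu.le

theorem dot_add {n : ℕ} (r : Fin n → ℚ) (u v : Fin n → ℤ) : dot r (u + v) = dot r u + dot r v := by
  simp [dot, mul_add, Finset.sum_add_distrib]

/-! ### The algebra `K{X; r}` -/

/-- The additive group of convergent Laurent series. -/
def convergentSeries (K : Type*) [NormedField K] {n : ℕ} (r : Fin n → ℚ) :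
    AddSubgroup ((Fin n → ℤ) → K) where
  carrier := {c | Converges r c}
  zero_mem' := by
    intro B
    simp [termVal_zero]
  add_mem' := by
    intro a b ha hb
    rw [Set.mem_ofPred_eq, converges_iff] at *
    have h := ha.add hb
    rw [add_zero] at h
    refine squeeze_zero (fun u => by positivity) (fun u => ?_) h
    rw [← add_mul]
    exact mul_le_mul_of_nonneg_right (norm_add_le _ _) (Real.exp_nonneg _)
  neg_mem' := by
    intro a ha
    rw [Set.mem_ofPred_eq, converges_iff] at *
    simpa using ha

/-- `K{X; r}`: Laurent series `∑ c_u X^u` with `val (c_u) - r · u → +∞`. -/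
def LaurentTate (K : Type*) [NormedField K] {n : ℕ} (r : Fin n → ℚ) : Type _ :=
  convergentSeries K r

namespace LaurentTate

variable {K : Type*} [NormedField K] {n : ℕ} {r : Fin n → ℚ}

instance : AddCommGroup (LaurentTate K r) :=
  inferInstanceAs (AddCommGroup (convergentSeries K r))

/-- The coefficient of `X^u`. -/
def coeff (f : LaurentTate K r) (u : Fin n → ℤ) : K := f.1 u

@[ext]
theorem ext {f g : LaurentTate K r} (h : ∀ u, f.coeff u = g.coeff u) : f = g :=
  Subtype.ext (funext h)

theorem converges (f : LaurentTate K r) : Converges r f.coeff := f.2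

@[simp] theorem coeff_add (f g : LaurentTate K r) (u : Fin n → ℤ) :
    (f + g).coeff u = f.coeff u + g.coeff u := rfl

@[simp] theorem coeff_sub (f g : LaurentTate K r) (u : Fin n → ℤ) :
    (f - g).coeff u = f.coeff u - g.coeff u := rfl

@[simp] theorem coeff_zero (u : Fin n → ℤ) : (0 : LaurentTate K r).coeff u = 0 := rfl

/-- The term `a X^u`, as an element of `K{X; r}`. -/
def term (r : Fin n → ℚ) (a : K) (u : Fin n → ℤ) : LaurentTate K r :=
  ⟨Pi.single u a, fun B => (Set.finite_singleton u).subset fun w hw => by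
    by_contra hne
    have : (Pi.single u a : (Fin n → ℤ) → K) w = 0 :=
      Pi.single_eq_of_ne (M := fun _ => K) hne a
    rw [Set.mem_ofPred_eq, this, termVal_zero] at hw
    exact not_top_lt hw⟩

theorem coeff_term (a : K) (u w : Fin n → ℤ) :
    (term r a u).coeff w = (Pi.single u a : (Fin n → ℤ) → K) w := rfl

theorem tendsto_pair (f g : LaurentTate K r) :
    Filter.Tendsto (fun p : (Fin n → ℤ) × (Fin n → ℤ) =>
      (‖f.coeff p.1‖ * Real.exp (dot r p.1)) * (‖g.coeff p.2‖ * Real.exp (dot r p.2)))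
      Filter.cofinite (𝓝 0) :=
  tendsto_mul_cofinite_nhds_zero ((converges_iff r _).1 f.converges)
    ((converges_iff r _).1 g.converges)

theorem exists_bound (f : LaurentTate K r) :
    ∃ M : ℝ, 0 ≤ M ∧ ∀ u, ‖f.coeff u‖ * Real.exp (dot r u) ≤ M := by
  have h := (converges_iff r _).1 f.converges
  have h2 := h.eventually (gt_mem_nhds one_pos)
  rw [Filter.eventually_cofinite] at h2
  obtain ⟨M, hM⟩ := (h2.image fun u => ‖f.coeff u‖ * Real.exp (dot r u)).bddAbove
  refine ⟨max M 1, by positivity, fun u => ?_⟩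
  by_cases hu : ‖f.coeff u‖ * Real.exp (dot r u) < 1
  · exact hu.le.trans (le_max_right _ _)
  · exact (hM ⟨u, hu, rfl⟩).trans (le_max_left _ _)

/-- The norms of `f_u g_{w-u}`, rescaled. -/
theorem norm_conv (f g : LaurentTate K r) (w u : Fin n → ℤ) :
    ‖f.coeff u * g.coeff (w - u)‖ * Real.exp (dot r w) =
      (‖f.coeff u‖ * Real.exp (dot r u)) *
        (‖g.coeff (w - u)‖ * Real.exp (dot r (w - u))) := by
  have h : dot r w = dot r u + dot r (w - u) := by rw [← dot_add, add_sub_cancel]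
  rw [norm_mul, h, Real.exp_add]
  ring

variable [IsUltrametricDist K]

theorem converges_mul (f g : LaurentTate K r) :
    Converges r fun w => ∑' u, f.coeff u * g.coeff (w - u) := by
  intro B
  have h := (tendsto_pair f g).eventually (gt_mem_nhds (Real.exp_pos (-B)))
  rw [Filter.eventually_cofinite] at h
  refine (h.image fun p => p.1 + p.2).subset fun w hw => ?_
  rw [Set.mem_ofPred_eq, termVal_lt_iff] at hw
  by_contra hcon
  refine absurd hw (not_lt.mpr ?_)
  rw [← le_div_iff₀ (Real.exp_pos _)]
  refine IsUltrametricDist.norm_tsum_le_of_forall_le_of_nonneg (by positivity) fun u => ?_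
  rw [le_div_iff₀ (Real.exp_pos _), norm_conv]
  by_contra hlt
  exact hcon ⟨(u, w - u), fun h' => hlt h'.le, by simp⟩

/-- The product of two Laurent series. -/
instance : Mul (LaurentTate K r) :=
  ⟨fun f g => ⟨fun w => ∑' u, f.coeff u * g.coeff (w - u), converges_mul f g⟩⟩

instance : One (LaurentTate K r) := ⟨term r 1 0⟩

theorem coeff_mul (f g : LaurentTate K r) (w : Fin n → ℤ) :
    (f * g).coeff w = ∑' u, f.coeff u * g.coeff (w - u) := rfl

theorem coeff_term_mul (a : K) (t : Fin n → ℤ) (f : LaurentTate K r) (w : Fin n → ℤ) :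
    (term r a t * f).coeff w = a * f.coeff (w - t) := by
  rw [coeff_mul, tsum_eq_single t, coeff_term, Pi.single_eq_same]
  intro u hu
  rw [coeff_term, Pi.single_eq_of_ne hu, zero_mul]

protected theorem mul_comm' (f g : LaurentTate K r) : f * g = g * f := by
  ext w
  rw [coeff_mul, coeff_mul, ← (Equiv.subLeft w).tsum_eq]
  refine tsum_congr fun u => ?_
  simp [mul_comm]

protected theorem one_mul' (f : LaurentTate K r) : 1 * f = f := by
  ext w
  rw [show (1 : LaurentTate K r) = term r 1 0 from rfl, coeff_term_mul]
  simp

variable [CompleteSpace K]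

theorem summable_conv (f g : LaurentTate K r) (w : Fin n → ℤ) :
    Summable fun u => f.coeff u * g.coeff (w - u) := by
  refine NonarchimedeanAddGroup.summable_of_tendsto_cofinite_zero ?_
  obtain ⟨M, hM0, hM⟩ := exists_bound g
  rw [tendsto_zero_iff_norm_tendsto_zero]
  have h := ((converges_iff r _).1 f.converges).mul_const (M / Real.exp (dot r w))
  rw [zero_mul] at h
  refine squeeze_zero (fun u => norm_nonneg _) (fun u => ?_) h
  rw [← mul_div_assoc, le_div_iff₀ (Real.exp_pos _), norm_conv]
  exact mul_le_mul_of_nonneg_left (hM _) (by positivity)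

theorem summable_triple (f g h : LaurentTate K r) (w : Fin n → ℤ) :
    Summable fun p : (Fin n → ℤ) × (Fin n → ℤ) =>
      f.coeff p.1 * g.coeff p.2 * h.coeff (w - p.1 - p.2) := by
  refine NonarchimedeanAddGroup.summable_of_tendsto_cofinite_zero ?_
  obtain ⟨M, hM0, hM⟩ := exists_bound h
  rw [tendsto_zero_iff_norm_tendsto_zero]
  have H := (tendsto_pair f g).mul_const (M / Real.exp (dot r w))
  rw [zero_mul] at H
  refine squeeze_zero (fun u => norm_nonneg _) (fun p => ?_) H
  rw [← mul_div_assoc, le_div_iff₀ (Real.exp_pos _)]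
  have e : dot r w = dot r p.1 + dot r p.2 + dot r (w - p.1 - p.2) := by
    rw [← dot_add, ← dot_add]; congr 1; abel
  have e2 : ‖f.coeff p.1 * g.coeff p.2 * h.coeff (w - p.1 - p.2)‖ * Real.exp (dot r w) =
      (‖f.coeff p.1‖ * Real.exp (dot r p.1) * (‖g.coeff p.2‖ * Real.exp (dot r p.2))) *
        (‖h.coeff (w - p.1 - p.2)‖ * Real.exp (dot r (w - p.1 - p.2))) := by
    rw [norm_mul, norm_mul, e, Real.exp_add, Real.exp_add]; ring
  rw [e2]
  exact mul_le_mul_of_nonneg_left (hM _) (by positivity)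

protected theorem mul_assoc' (f g h : LaurentTate K r) : f * g * h = f * (g * h) := by
  ext w
  have S := summable_triple f g h w
  have e1 : (f * (g * h)).coeff w = ∑' p : (Fin n → ℤ) × (Fin n → ℤ),
      f.coeff p.1 * g.coeff p.2 * h.coeff (w - p.1 - p.2) := by
    rw [S.tsum_prod, coeff_mul]
    refine tsum_congr fun a => ?_
    rw [coeff_mul, ← tsum_mul_left]
    exact tsum_congr fun b => (mul_assoc _ _ _).symm
  rw [e1]
  let E : (Fin n → ℤ) × (Fin n → ℤ) ≃ (Fin n → ℤ) × (Fin n → ℤ) :=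
    { toFun := fun p => (p.2, p.1 - p.2)
      invFun := fun p => (p.1 + p.2, p.1)
      left_inv := fun p => by simp
      right_inv := fun p => by simp }
  have S' := (E.summable_iff).2 S
  rw [← E.tsum_eq]
  refine Eq.trans ?_ S'.tsum_prod.symm
  rw [coeff_mul]
  refine tsum_congr fun c => ?_
  rw [coeff_mul, ← tsum_mul_right]
  refine tsum_congr fun a => ?_
  simp [E]

protected theorem add_mul' (f g h : LaurentTate K r) : (f + g) * h = f * h + g * h := by
  ext w
  rw [coeff_add, coeff_mul, coeff_mul, coeff_mul,
    ← (summable_conv f h w).tsum_add (summable_conv g h w)]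
  exact tsum_congr fun u => by rw [coeff_add, add_mul]

instance : CommRing (LaurentTate K r) :=
  { (inferInstance : AddCommGroup (LaurentTate K r)) with
    mul_assoc := LaurentTate.mul_assoc'
    one_mul := LaurentTate.one_mul'
    mul_one := fun f => by rw [LaurentTate.mul_comm', LaurentTate.one_mul']
    left_distrib := fun f g h => by
      rw [LaurentTate.mul_comm', LaurentTate.add_mul', LaurentTate.mul_comm' f,
        LaurentTate.mul_comm' f]
    right_distrib := LaurentTate.add_mul'
    zero_mul := fun f => by ext w; simp [coeff_mul]
    mul_zero := fun f => by ext w; simp [coeff_mul]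
    mul_comm := LaurentTate.mul_comm' }

end LaurentTate

/-! ### Conic decompositions and generalized monomial orders -/

/-- A conic decomposition of the group `T` of monomials in `n` variables, indexed by `I`. -/
structure ConicDecomposition (n : ℕ) (I : Type*) [Finite I] where
  /-- The monoids `T_i`. -/
  cone : I → AddSubmonoid (Fin n → ℤ)
  fg : ∀ i, (cone i).FG
  pointed : ∀ i, ∀ t ∈ cone i, -t ∈ cone i → t = 0
  generates : ∀ i, AddSubgroup.closure (cone i : Set (Fin n → ℤ)) = ⊤
  cover : ∀ t, ∃ i, t ∈ cone i

/-- A generalized monomial order on `T` for a conic decomposition. -/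
structure GMO {n : ℕ} {I : Type*} [Finite I] (C : ConicDecomposition n I) where
  /-- The order relation on monomials. -/
  le : (Fin n → ℤ) → (Fin n → ℤ) → Prop
  refl : ∀ s, le s s
  trans : ∀ s t u, le s t → le t u → le s u
  antisymm : ∀ s t, le s t → le t s → s = t
  total : ∀ s t, le s t ∨ le t s
  one_le : ∀ t, le 0 t
  mul_lt : ∀ (r : Fin n → ℤ) (i : I), ∀ s ∈ C.cone i, ∀ t ∈ C.cone i,
    (le r s ∧ r ≠ s) → (le (r + t) (s + t) ∧ r + t ≠ s + t)

variable {K : Type*} [NormedField K] {n : ℕ} {r : Fin n → ℚ} {I : Type*} [Finite I]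
  {C : ConicDecomposition n I}

/-- The preorder `≤_r` on terms: `a X^u ≤_r b X^v`. -/
def TermLE (ω : GMO C) (r : Fin n → ℚ) (a : K) (u : Fin n → ℤ) (b : K) (v : Fin n → ℤ) : Prop :=
  termVal r b v < termVal r a u ∨ (termVal r a u = termVal r b v ∧ ω.le u v)

/-! ### Leading data of a Laurent polynomial -/

/-- `u` is the largest monomial of `p`. -/
def IsLeading (ω : GMO C) (p : AddMonoidAlgebra K (Fin n → ℤ)) (u : Fin n → ℤ) : Prop :=
  p.coeff u ≠ 0 ∧ ∀ w, p.coeff w ≠ 0 → ω.le w u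

/-- The leading monomial of a nonzero Laurent polynomial. -/
def polyLM (ω : GMO C) (p : AddMonoidAlgebra K (Fin n → ℤ)) : Fin n → ℤ :=
  open Classical in if h : ∃ u, IsLeading ω p u then h.choose else 0

/-- `T_i(p)`: the monomials `t` with `lm (t p) ∈ T_i`. -/
def polyT (ω : GMO C) (i : I) (p : AddMonoidAlgebra K (Fin n → ℤ)) : Set (Fin n → ℤ) :=
  {t | polyLM ω (AddMonoidAlgebra.single t 1 * p) ∈ C.cone i}

/-- `lm_i (p) = lm (t p) t⁻¹` for any `t ∈ T_i(p)`. -/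
def polyLMi (ω : GMO C) (i : I) (p : AddMonoidAlgebra K (Fin n → ℤ)) : Fin n → ℤ :=
  open Classical in
  if h : ∃ t, t ∈ polyT ω i p then
    polyLM ω (AddMonoidAlgebra.single h.choose 1 * p) - h.choose
  else 0

/-! ### Leading data of a series, through its initial form -/

theorem finite_initial (f : LaurentTate K r) :
    {u | f.coeff u ≠ 0 ∧ ∀ w, termVal r (f.coeff u) u ≤ termVal r (f.coeff w) w}.Finite := by
  by_cases hf : ∃ u, f.coeff u ≠ 0
  · obtain ⟨u₀, hu₀⟩ := hf
    have hne : termVal r (f.coeff u₀) u₀ ≠ ⊤ := by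
      rw [termVal, val, if_neg hu₀, ← WithTop.coe_add]
      exact WithTop.coe_ne_top
    obtain ⟨B, hB⟩ := WithTop.ne_top_iff_exists.1 hne
    refine (f.converges (B + 1)).subset fun u hu => ?_
    refine (hu.2 u₀).trans_lt ?_
    rw [← hB, WithTop.coe_lt_coe]
    exact lt_add_one B
  · exact Set.finite_empty.subset fun u hu => hf ⟨u, hu.1⟩

/-- `in_r (f)`: the sum of the terms of `f` whose valuation is `val_r (f)`, the minimum of the
valuations of all terms. -/
def inr (f : LaurentTate K r) : AddMonoidAlgebra K (Fin n → ℤ) :=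
  open Classical in
  AddMonoidAlgebra.ofCoeff (Finsupp.onFinset (finite_initial f).toFinset
    (fun u => if f.coeff u ≠ 0 ∧ ∀ w, termVal r (f.coeff u) u ≤ termVal r (f.coeff w) w
      then f.coeff u else 0)
    (fun u hu => by
      rw [Set.Finite.mem_toFinset, Set.mem_ofPred_eq]
      by_contra hcon
      exact hu (if_neg hcon)))

/-- The leading monomial `lm (f)`. -/
def lm (ω : GMO C) (f : LaurentTate K r) : Fin n → ℤ := polyLM ω (inr f)

/-- The leading coefficient `lc (f)`. -/
def lc (ω : GMO C) (f : LaurentTate K r) : K := f.coeff (lm ω f)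

/-- The leading term `lt (f)`. -/
def lt (ω : GMO C) (f : LaurentTate K r) : LaurentTate K r :=
  LaurentTate.term r (lc ω f) (lm ω f)

/-- `T_i(f)`. -/
def coneSet (ω : GMO C) (i : I) (f : LaurentTate K r) : Set (Fin n → ℤ) := polyT ω i (inr f)

/-- `lm_i (f)`. -/
def lmi (ω : GMO C) (i : I) (f : LaurentTate K r) : Fin n → ℤ := polyLMi ω i (inr f)

/-- `lc_i (f)`, the coefficient of `lm_i (f)` in `f`. -/
def lci (ω : GMO C) (i : I) (f : LaurentTate K r) : K := f.coeff (lmi ω i f)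

/-- The set `lm_i (f) T_i(f)`. -/
def leadSet (ω : GMO C) (i : I) (f : LaurentTate K r) : Set (Fin n → ℤ) :=
  {v | ∃ t ∈ coneSet ω i f, v = lmi ω i f + t}

theorem inr_coeff_ne_zero_iff (f : LaurentTate K r) (u : Fin n → ℤ) :
    (inr f).coeff u ≠ 0 ↔
      f.coeff u ≠ 0 ∧ ∀ w, termVal r (f.coeff u) u ≤ termVal r (f.coeff w) w := by
  classical
  rw [inr, AddMonoidAlgebra.coeff_ofCoeff, Finsupp.onFinset_apply]
  split_ifs with h
  · exact ⟨fun _ => h, fun _ => h.1⟩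
  · exact ⟨fun h' => absurd rfl h', fun h' => absurd h' h⟩

/-- The leading term of a series is its largest term for the preorder `≤_r`. -/
theorem isLeading_inr_iff (ω : GMO C) (f : LaurentTate K r) (u : Fin n → ℤ) :
    IsLeading ω (inr f) u ↔
      f.coeff u ≠ 0 ∧ ∀ w, f.coeff w ≠ 0 → TermLE ω r (f.coeff w) w (f.coeff u) u := by
  constructor
  · rintro ⟨h1, h2⟩
    rw [inr_coeff_ne_zero_iff] at h1
    refine ⟨h1.1, fun w hw => ?_⟩
    rcases (h1.2 w).lt_or_eq with h | h
    · exact Or.inl h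
    · exact Or.inr ⟨h.symm, h2 w ((inr_coeff_ne_zero_iff f w).2 ⟨hw, fun w' => h ▸ h1.2 w'⟩)⟩
  · rintro ⟨h1, h2⟩
    have hmin : ∀ w, termVal r (f.coeff u) u ≤ termVal r (f.coeff w) w := by
      intro w
      by_cases hw : f.coeff w = 0
      · rw [hw, termVal_zero]; exact le_top
      · rcases h2 w hw with h | h
        · exact h.le
        · exact h.1.ge
    refine ⟨(inr_coeff_ne_zero_iff f u).2 ⟨h1, hmin⟩, fun w hw => ?_⟩
    rw [inr_coeff_ne_zero_iff] at hw
    rcases h2 w hw.1 with h | h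
    · exact absurd (hw.2 u) (not_le.mpr h)
    · exact h.2

/-! ### Gröbner bases, S-pairs and division -/

variable [IsUltrametricDist K] [CompleteSpace K]

/-- `G` is a Gröbner basis of the ideal `J`: a finite subset of `J \ {0}` with
`lm (J) = ⋃ T_i(g) lm_i (g)`. -/
def IsGroebnerBasis (ω : GMO C) (J : Ideal (LaurentTate K r)) (G : Set (LaurentTate K r)) :
    Prop :=
  G.Finite ∧ (∀ g ∈ G, g ∈ J ∧ g ≠ 0) ∧
    {u | ∃ f ∈ J, f ≠ 0 ∧ u = lm ω f} = {u | ∃ g ∈ G, ∃ i, u ∈ leadSet ω i g}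

/-- The S-pair `S(i, f, g, v)`. -/
def sPair (ω : GMO C) (i : I) (f g : LaurentTate K r) (v : Fin n → ℤ) : LaurentTate K r :=
  LaurentTate.term r (lci ω i g) (v - lmi ω i f) * f -
    LaurentTate.term r (lci ω i f) (v - lmi ω i g) * g

/-- `U` is a (finite) system of generators of the `T_i`-module `M`. -/
def Generates (C : ConicDecomposition n I) (i : I) (U : Finset (Fin n → ℤ))
    (M : Set (Fin n → ℤ)) : Prop :=
  M = {w | ∃ t ∈ C.cone i, ∃ v ∈ U, w = t + v}

/-- A state of the multivariate division algorithm by `m` series: the current dividend, the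
current quotients and the current remainder. -/
structure DivState (K : Type*) [NormedField K] {n : ℕ} (r : Fin n → ℚ) (m : ℕ) where
  /-- The current dividend. -/
  f : LaurentTate K r
  /-- The current quotients. -/
  q : Fin m → LaurentTate K r
  /-- The current remainder. -/
  s : LaurentTate K r

/-- The leading term of `f` can be cancelled by `g` through the cone `T_i`, that is,
`lm ((lm (f) / lm_i (g)) g) = lm (f)`. -/
def Reducible (ω : GMO C) (f g : LaurentTate K r) (i : I) : Prop :=
  lm ω (LaurentTate.term r 1 (lm ω f - lmi ω i g) * g) = lm ω f

/-- One step of the division algorithm by `h`: while the dividend is nonzero, cancel its leading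
term with some `h_j` if this is possible, and otherwise move its leading term to the remainder.
The algorithm is idle once the dividend is zero. -/
def DivStep (ω : GMO C) {m : ℕ} (h : Fin m → LaurentTate K r) (a b : DivState K r m) : Prop :=
  (a.f = 0 ∧ b = a) ∨
  (a.f ≠ 0 ∧ ∃ (i : I) (j : Fin m), Reducible ω a.f (h j) i ∧
    b.f = a.f - LaurentTate.term r (lc ω a.f / lci ω i (h j)) (lm ω a.f - lmi ω i (h j)) * h j ∧
    b.q = a.q + Pi.single j
      (LaurentTate.term r (lc ω a.f / lci ω i (h j)) (lm ω a.f - lmi ω i (h j))) ∧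
    b.s = a.s) ∨
  (a.f ≠ 0 ∧ (¬ ∃ (i : I) (j : Fin m), Reducible ω a.f (h j) i) ∧
    b.f = a.f - lt ω a.f ∧ b.q = a.q ∧ b.s = a.s + lt ω a.f)

/-- Convergence of a sequence in `K{X; r}` for the valuation `val_r`. -/
def ConvergesTo (x : ℕ → LaurentTate K r) (y : LaurentTate K r) : Prop :=
  ∀ B : ℝ, ∃ N, ∀ k ≥ N, ∀ u, (B : WithTop ℝ) ≤ termVal r ((x k - y).coeff u) u

/-- `(q, s)` is an output of the division algorithm applied to `f` and `h`: the limit of the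
quotients and remainders along a (possibly infinite) execution. -/
def IsDivisionOutput (ω : GMO C) {m : ℕ} (h : Fin m → LaurentTate K r) (f : LaurentTate K r)
    (q : Fin m → LaurentTate K r) (s : LaurentTate K r) : Prop :=
  ∃ σ : ℕ → DivState K r m, (σ 0).f = f ∧ (σ 0).q = 0 ∧ (σ 0).s = 0 ∧
    (∀ k, DivStep ω h (σ k) (σ (k + 1))) ∧
    (∀ j, ConvergesTo (fun k => (σ k).q j) (q j)) ∧ ConvergesTo (fun k => (σ k).s) s

/-- `s` is a remainder `rem (f, h)` produced by the division algorithm. -/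
def IsRem (ω : GMO C) {m : ℕ} (h : Fin m → LaurentTate K r) (f s : LaurentTate K r) : Prop :=
  ∃ q, IsDivisionOutput ω h f q s

end

end LaurentGB

namespace LaurentGB

noncomputable section

/-! ### The well-order on monomials -/

section Order

variable {n : ℕ} {I : Type*} [Finite I] {C : ConicDecomposition n I}

/-! Each term `a X^u` receives a key: the pair of its absolute value `‖a‖ exp (r · u)` and its
monomial, ordered lexicographically. The preorder on terms becomes the order on keys, and the
leading term is the one with the largest key. Monomials are well-ordered, by Dickson's lemma in each
cone (`isPWO_cone`), but keys are not, since absolute values can decrease forever. The remedy is to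
confine absolute values to a set `E` that accumulates only at zero: above any positive bound `E` is
finite, so the keys there are well-founded (`wellFounded_lex`). Such an `E` can be closed under
multiplication by a locally finite set of factors at most one (`exists_locFin_closed`). Discreteness
enters here: the norm `π` of the uniformizer is taken as one of the factors, and closure under `π`
absorbs every drop of absolute value caused by cancellation (`tn_add_mem`).

For division, leading keys decrease strictly while values stay in one such `E`, so dividends tend to
zero (`tendsto_dividend`) and the outputs converge (`exists_isRem`). If `H` is a Gröbner basis,
every nonzero element of the ideal is reducible, so no term ever enters the remainder
(`isRem_eq_zero`).

Conversely, zero remainders express each S-pair by products strictly below its cancelled leading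
terms (`exists_standard_representation`). Among the representations of `f` in the ideal with values
in a suitable `E`, one has a minimal largest key. If that key exceeds the leading key of `f`, the
terms reaching it cancel, and the S-pairs rewrite them with smaller keys, still in `E`
(`exists_lower_representation`), against minimality. Hence the two keys agree, and `lm f` is the
leading monomial of a multiple of some `h j` (`exists_lm_mem_leadSet`). No limit of representations
is needed, because the Gauss norm of `f` bounds all these keys from below. -/

/-- The monomials, equipped with the generalized monomial order `ω`. -/
def Mon (_ω : GMO C) : Type := Fin n → ℤ

instance (ω : GMO C) : LinearOrder (Mon ω) where
  le := ω.le
  le_refl := ω.refl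
  le_trans := ω.trans
  le_antisymm := ω.antisymm
  le_total := ω.total
  toDecidableLE := Classical.decRel _

/-- The exponent `u`, as an element of the ordered type `Mon ω`. -/
def mon (ω : GMO C) (u : Fin n → ℤ) : Mon ω := u

theorem mon_injective (ω : GMO C) : Function.Injective (mon ω) := fun _ _ h => h

theorem mon_le_iff (ω : GMO C) {u v : Fin n → ℤ} : mon ω u ≤ mon ω v ↔ ω.le u v := Iff.rfl

theorem mon_add_lt (ω : GMO C) {i : I} {u s t : Fin n → ℤ} (hs : s ∈ C.cone i)
    (ht : t ∈ C.cone i) (h : mon ω u < mon ω s) : mon ω (u + t) < mon ω (s + t) := by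
  have h1 := ω.mul_lt u i s hs t ht ⟨h.le, fun e => h.ne (congrArg (mon ω) e)⟩
  exact lt_of_le_of_ne h1.1 fun e => h1.2 (mon_injective ω e)

theorem mon_zero_le (ω : GMO C) (u : Fin n → ℤ) : mon ω 0 ≤ mon ω u := ω.one_le u

theorem mon_le_add (ω : GMO C) {i : I} {s t : Fin n → ℤ} (hs : s ∈ C.cone i)
    (ht : t ∈ C.cone i) : mon ω t ≤ mon ω (s + t) := by
  rcases (mon_zero_le ω s).lt_or_eq with h | h
  · simpa using (mon_add_lt ω hs ht h).le
  · rw [← mon_injective ω h, zero_add]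

/-- Dickson's lemma: a finite generating set makes the cone the image of some `ℕ^S`. The map is
monotone because adding an element of the cone never decreases an element of the same cone. -/
theorem isPWO_cone (ω : GMO C) (i : I) : {u : Mon ω | ∃ s ∈ C.cone i, mon ω s = u}.IsPWO := by
  classical
  obtain ⟨S, hS⟩ := C.fg i
  let φ : (S → ℕ) → Fin n → ℤ := fun a => ∑ s, a s • (s : Fin n → ℤ)
  have hφ : ∀ a, φ a ∈ C.cone i := fun a => sum_mem fun s _ =>
    nsmul_mem (hS ▸ AddSubmonoid.subset_closure s.2) _
  have hmono : Monotone fun a => mon ω (φ a) := by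
    intro a b hab
    have e : φ b = φ (b - a) + φ a := by
      simp only [φ, ← Finset.sum_add_distrib, ← add_smul]
      refine Finset.sum_congr rfl fun s _ => ?_
      rw [Pi.sub_apply, Nat.sub_add_cancel (hab s)]
    simpa only [e] using mon_le_add ω (hφ (b - a)) (hφ a)
  have hsurj : ∀ s ∈ C.cone i, ∃ a, φ a = s := by
    intro s hs
    rw [← hS] at hs
    induction hs using AddSubmonoid.closure_induction with
    | mem x hx =>
      refine ⟨Pi.single ⟨x, hx⟩ 1, ?_⟩
      simp only [φ]
      rw [Finset.sum_eq_single ⟨x, hx⟩]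
      · simp
      · intro b _ hb
        simp [hb]
      · simp
    | zero => exact ⟨0, by simp [φ]⟩
    | add x y _ _ hx hy =>
      obtain ⟨a, rfl⟩ := hx
      obtain ⟨b, rfl⟩ := hy
      exact ⟨a + b, by
        simp only [φ, Pi.add_apply, add_smul, Finset.sum_add_distrib]⟩
  have h := (Set.isPWO_of_wellQuasiOrderedLE (Set.univ : Set (S → ℕ))).image_of_monotone hmono
  refine h.mono ?_
  rintro _ ⟨s, hs, rfl⟩
  obtain ⟨a, rfl⟩ := hsurj s hs
  exact ⟨a, trivial, rfl⟩

instance (ω : GMO C) : WellFoundedLT (Mon ω) := by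
  refine Set.isWF_univ_iff.1 ?_
  refine Set.IsWF.mono (t := ⋃ i, {u : Mon ω | ∃ s ∈ C.cone i, mon ω s = u}) ?_ ?_
  · have := Fintype.ofFinite I
    have h := Finset.isWF_bUnion (Finset.univ : Finset I)
      (f := fun i => {u : Mon ω | ∃ s ∈ C.cone i, mon ω s = u})
    simpa using h.2 fun i _ => (isPWO_cone ω i).isWF
  · intro u _
    obtain ⟨i, hi⟩ := C.cover u
    exact Set.mem_iUnion.2 ⟨i, u, hi, rfl⟩

theorem exists_sub_mem_cone (C : ConicDecomposition n I) (i : I) (u : Fin n → ℤ) :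
    ∃ s ∈ C.cone i, ∃ t ∈ C.cone i, u = s - t := by
  have hu : u ∈ AddSubgroup.closure (C.cone i : Set (Fin n → ℤ)) := C.generates i ▸ trivial
  induction hu using AddSubgroup.closure_induction with
  | mem x hx => exact ⟨x, hx, 0, zero_mem _, by simp⟩
  | zero => exact ⟨0, zero_mem _, 0, zero_mem _, by simp⟩
  | add x y _ _ hx hy =>
    obtain ⟨a, ha, b, hb, rfl⟩ := hx
    obtain ⟨c, hc, d, hd, rfl⟩ := hy
    exact ⟨a + c, add_mem ha hc, b + d, add_mem hb hd, by abel⟩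
  | neg x _ hx =>
    obtain ⟨a, ha, b, hb, rfl⟩ := hx
    exact ⟨b, hb, a, ha, by abel⟩

/-- Every monomial is a difference `x - y` in the cone. Adding `y` repairs one element and keeps in
the cone those already moved there. -/
theorem exists_add_mem_cone (C : ConicDecomposition n I) (i : I) {F : Set (Fin n → ℤ)}
    (hF : F.Finite) : ∃ t, ∀ u ∈ F, t + u ∈ C.cone i := by
  induction F, hF using Set.Finite.induction_on with
  | empty => exact ⟨0, by simp⟩
  | @insert a F _ _ ih =>
    obtain ⟨t, ht⟩ := ih
    obtain ⟨x, hx, y, hy, e⟩ := exists_sub_mem_cone C i (t + a)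
    refine ⟨t + y, fun u hu => ?_⟩
    rcases hu with rfl | hu
    · rw [show t + y + u = (t + u) + y by abel, e, sub_add_cancel]
      exact hx
    · rw [show t + y + u = (t + u) + y by abel]
      exact add_mem (ht u hu) hy

end Order

/-! ### Absolute values of terms -/

section TermNorm

variable {K : Type*} [NormedField K] {n : ℕ}

/-- The absolute value `‖a‖ exp (r · u)` of the term `a X^u`. -/
def tn (r : Fin n → ℚ) (a : K) (u : Fin n → ℤ) : ℝ := ‖a‖ * Real.exp (dot r u)

variable (r : Fin n → ℚ)

@[simp] theorem tn_zero (u : Fin n → ℤ) : tn r (0 : K) u = 0 := by simp [tn]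

theorem tn_nonneg (a : K) (u : Fin n → ℤ) : 0 ≤ tn r a u := by unfold tn; positivity

theorem tn_pos_iff {a : K} {u : Fin n → ℤ} : 0 < tn r a u ↔ a ≠ 0 := by
  unfold tn
  rw [mul_pos_iff_of_pos_right (Real.exp_pos _), norm_pos_iff]

theorem tn_eq_zero_iff {a : K} {u : Fin n → ℤ} : tn r a u = 0 ↔ a = 0 := by
  unfold tn
  simp [Real.exp_ne_zero]

theorem tn_mul (a b : K) (u v : Fin n → ℤ) : tn r (a * b) (u + v) = tn r a u * tn r b v := by
  simp only [tn, norm_mul, dot_add, Real.exp_add]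
  ring

theorem tn_neg (a : K) (u : Fin n → ℤ) : tn r (-a) u = tn r a u := by simp [tn]

theorem tn_add_le [IsUltrametricDist K] (a b : K) (u : Fin n → ℤ) :
    tn r (a + b) u ≤ max (tn r a u) (tn r b u) := by
  unfold tn
  rw [← max_mul_of_nonneg _ _ (Real.exp_nonneg _)]
  exact mul_le_mul_of_nonneg_right (IsUltrametricDist.norm_add_le_max a b) (Real.exp_nonneg _)

theorem tn_sub_le [IsUltrametricDist K] (a b : K) (u : Fin n → ℤ) :
    tn r (a - b) u ≤ max (tn r a u) (tn r b u) := by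
  rw [sub_eq_add_neg]
  simpa [tn_neg] using tn_add_le r a (-b) u

theorem tn_le_tn_iff {a b : K} {u : Fin n → ℤ} : tn r a u ≤ tn r b u ↔ ‖a‖ ≤ ‖b‖ :=
  mul_le_mul_iff_of_pos_right (Real.exp_pos _)

theorem termVal_eq {a : K} (ha : a ≠ 0) (u : Fin n → ℤ) :
    termVal r a u = ((-Real.log (tn r a u) : ℝ) : WithTop ℝ) := by
  rw [termVal, val, if_neg ha, ← WithTop.coe_add, tn,
    Real.log_mul (norm_ne_zero_iff.2 ha) (Real.exp_ne_zero _), Real.log_exp, neg_add]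

theorem termVal_lt_termVal_iff {a b : K} (hb : b ≠ 0) {u v : Fin n → ℤ} :
    termVal r b v < termVal r a u ↔ tn r a u < tn r b v := by
  by_cases ha : a = 0
  · rw [ha, termVal_zero, termVal_eq r hb, tn_zero, tn_pos_iff]
    exact iff_of_true (WithTop.coe_lt_top _) hb
  · rw [termVal_eq r ha, termVal_eq r hb, WithTop.coe_lt_coe, neg_lt_neg_iff,
      Real.log_lt_log_iff ((tn_pos_iff r).2 ha) ((tn_pos_iff r).2 hb)]

theorem termVal_eq_termVal_iff {a b : K} (ha : a ≠ 0) (hb : b ≠ 0) {u v : Fin n → ℤ} :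
    termVal r a u = termVal r b v ↔ tn r a u = tn r b v := by
  rw [termVal_eq r ha, termVal_eq r hb, WithTop.coe_eq_coe, neg_inj]
  exact ⟨fun h => Real.log_injOn_pos ((tn_pos_iff r).2 ha) ((tn_pos_iff r).2 hb) h,
    fun h => h ▸ rfl⟩

theorem le_termVal_iff {a : K} {u : Fin n → ℤ} {B : ℝ} :
    (B : WithTop ℝ) ≤ termVal r a u ↔ tn r a u ≤ Real.exp (-B) := by
  rw [← not_lt, termVal_lt_iff, not_lt, tn]

end TermNorm

/-! ### Leading monomials through lexicographic keys -/

section Key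

variable {K : Type*} [NormedField K] {n : ℕ} {r : Fin n → ℚ} {I : Type*} [Finite I]
  {C : ConicDecomposition n I}

/-- The pair formed by an absolute value and a monomial, in the lexicographic order. -/
def mk (ω : GMO C) (b : ℝ) (v : Fin n → ℤ) : ℝ ×ₗ Mon ω := toLex (b, mon ω v)

theorem mk_lt_mk (ω : GMO C) {b c : ℝ} {u v : Fin n → ℤ} :
    mk ω b u < mk ω c v ↔ b < c ∨ b = c ∧ mon ω u < mon ω v := Prod.Lex.toLex_lt_toLex

theorem mk_le_mk (ω : GMO C) {b c : ℝ} {u v : Fin n → ℤ} :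
    mk ω b u ≤ mk ω c v ↔ b < c ∨ b = c ∧ mon ω u ≤ mon ω v := Prod.Lex.toLex_le_toLex

theorem mk_injective (ω : GMO C) {b c : ℝ} {u v : Fin n → ℤ} (h : mk ω b u = mk ω c v) :
    b = c ∧ u = v := Prod.ext_iff.1 (toLex_inj.1 h)

theorem fst_le_of_mk_le (ω : GMO C) {b c : ℝ} {u v : Fin n → ℤ} (h : mk ω b u ≤ mk ω c v) :
    b ≤ c := (mk_le_mk ω).1 h |>.elim le_of_lt fun h => h.1.le

theorem mk_mono_left (ω : GMO C) {b c : ℝ} (u : Fin n → ℤ) (h : b ≤ c) :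
    mk ω b u ≤ mk ω c u := (mk_le_mk ω).2 (h.lt_or_eq.imp id fun h => ⟨h, le_rfl⟩)

theorem mk_max (ω : GMO C) (b c : ℝ) (u : Fin n → ℤ) :
    mk ω (max b c) u = max (mk ω b u) (mk ω c u) :=
  (show Monotone fun b => mk ω b u from fun _ _ h => mk_mono_left ω u h).map_max

/-- The key of the term of `f` of exponent `w`. -/
def key (ω : GMO C) (f : LaurentTate K r) (w : Fin n → ℤ) : ℝ ×ₗ Mon ω :=
  mk ω (tn r (f.coeff w) w) w

/-- The key of the leading term of `f`. -/
def leadKey (ω : GMO C) (f : LaurentTate K r) : ℝ ×ₗ Mon ω := key ω f (lm ω f)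

/-- The Gauss norm of `f`. -/
def gauss (ω : GMO C) (f : LaurentTate K r) : ℝ := tn r (lc ω f) (lm ω f)

theorem leadKey_eq (ω : GMO C) (f : LaurentTate K r) :
    leadKey ω f = mk ω (gauss ω f) (lm ω f) := rfl

/-- A zero coefficient gives a key with first component `0`, below the key of any nonzero term, so
the maximum may be taken over all exponents instead of the support. -/
theorem isLeading_inr_iff_key (ω : GMO C) (f : LaurentTate K r) (u : Fin n → ℤ) :
    IsLeading ω (inr f) u ↔ f.coeff u ≠ 0 ∧ ∀ w, key ω f w ≤ key ω f u := by
  rw [isLeading_inr_iff]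
  refine and_congr_right fun hu => forall_congr' fun w => ?_
  unfold key
  rw [mk_le_mk]
  by_cases hw : f.coeff w = 0
  · simp [hw, tn_pos_iff, hu]
  · simp only [TermLE, termVal_lt_termVal_iff r hu, termVal_eq_termVal_iff r hw hu, mon_le_iff,
      ne_eq, hw, not_false_eq_true, true_implies]

theorem isLeading_unique (ω : GMO C) {p : AddMonoidAlgebra K (Fin n → ℤ)} {u v : Fin n → ℤ}
    (hu : IsLeading ω p u) (hv : IsLeading ω p v) : u = v :=
  ω.antisymm _ _ (hv.2 u hu.1) (hu.2 v hv.1)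

theorem polyLM_eq (ω : GMO C) {p : AddMonoidAlgebra K (Fin n → ℤ)} {u : Fin n → ℤ}
    (hu : IsLeading ω p u) : polyLM ω p = u := by
  have h : ∃ u, IsLeading ω p u := ⟨u, hu⟩
  rw [polyLM, dif_pos h]
  exact isLeading_unique ω h.choose_spec hu

theorem finite_le_tn (f : LaurentTate K r) {b : ℝ} (hb : 0 < b) :
    {u | b ≤ tn r (f.coeff u) u}.Finite := by
  have h := ((converges_iff r _).1 f.converges).eventually (gt_mem_nhds hb)
  rw [Filter.eventually_cofinite] at h
  exact h.subset fun u hu => not_lt.2 hu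

theorem exists_coeff_ne_zero {f : LaurentTate K r} (hf : f ≠ 0) : ∃ u, f.coeff u ≠ 0 := by
  by_contra! h
  exact hf (LaurentTate.ext h)

/-- Only finitely many terms are at least as large as a given nonzero one, and the largest key is
found among them. -/
theorem exists_isLeading (ω : GMO C) {f : LaurentTate K r} (hf : f ≠ 0) :
    ∃ u, IsLeading ω (inr f) u := by
  obtain ⟨u₀, hu₀⟩ := exists_coeff_ne_zero hf
  have hpos := (tn_pos_iff r (u := u₀)).2 hu₀
  obtain ⟨u, hu, hmax⟩ := Set.exists_max_image _ (key ω f) (finite_le_tn f hpos)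
    ⟨u₀, le_refl (tn r (f.coeff u₀) u₀)⟩
  refine ⟨u, (isLeading_inr_iff_key ω f u).2
    ⟨(tn_pos_iff r).1 (hpos.trans_le hu), fun w => ?_⟩⟩
  by_cases hw : tn r (f.coeff u₀) u₀ ≤ tn r (f.coeff w) w
  · exact hmax w hw
  · exact (mk_le_mk ω).2 (Or.inl ((not_le.1 hw).trans_le hu))

theorem isLeading_lm (ω : GMO C) {f : LaurentTate K r} (hf : f ≠ 0) :
    IsLeading ω (inr f) (lm ω f) := by
  obtain ⟨u, hu⟩ := exists_isLeading ω hf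
  rw [lm, polyLM_eq ω hu]
  exact hu

theorem lc_ne_zero (ω : GMO C) {f : LaurentTate K r} (hf : f ≠ 0) : lc ω f ≠ 0 :=
  ((isLeading_inr_iff_key ω f _).1 (isLeading_lm ω hf)).1

theorem gauss_pos (ω : GMO C) {f : LaurentTate K r} (hf : f ≠ 0) : 0 < gauss ω f :=
  (tn_pos_iff r).2 (lc_ne_zero ω hf)

@[simp] theorem gauss_zero (ω : GMO C) : gauss ω (0 : LaurentTate K r) = 0 := by
  simp [gauss, lc]

theorem key_le_leadKey (ω : GMO C) {f : LaurentTate K r} (hf : f ≠ 0) (w : Fin n → ℤ) :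
    key ω f w ≤ leadKey ω f :=
  ((isLeading_inr_iff_key ω f _).1 (isLeading_lm ω hf)).2 w

theorem tn_le_gauss (ω : GMO C) (f : LaurentTate K r) (w : Fin n → ℤ) :
    tn r (f.coeff w) w ≤ gauss ω f := by
  by_cases hf : f = 0
  · subst hf
    simp
  · exact fst_le_of_mk_le ω (key_le_leadKey ω hf w)

theorem lm_eq_of_key_le (ω : GMO C) {f : LaurentTate K r} {u : Fin n → ℤ}
    (hu : f.coeff u ≠ 0) (h : ∀ w, key ω f w ≤ key ω f u) : lm ω f = u :=
  polyLM_eq ω ((isLeading_inr_iff_key ω f u).2 ⟨hu, h⟩)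

theorem lm_eq_of_key_eq (ω : GMO C) {f : LaurentTate K r} {u : Fin n → ℤ} {κ : ℝ ×ₗ Mon ω}
    (h : ∀ w, key ω f w ≤ κ) (hu : key ω f u = κ) (h0 : f.coeff u ≠ 0) : lm ω f = u :=
  lm_eq_of_key_le ω h0 fun w => hu ▸ h w

open Classical in
theorem coeff_inr (f : LaurentTate K r) (u : Fin n → ℤ) :
    (inr f).coeff u = if ∀ w, tn r (f.coeff w) w ≤ tn r (f.coeff u) u then f.coeff u else 0 := by
  rw [inr, AddMonoidAlgebra.coeff_ofCoeff, Finsupp.onFinset_apply]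
  by_cases hu : f.coeff u = 0
  · simp [hu]
  · refine if_congr ?_ rfl rfl
    rw [and_iff_right hu]
    refine forall_congr' fun w => ?_
    by_cases hw : f.coeff w = 0
    · simp [hw, termVal_zero, tn_nonneg]
    · rw [← not_lt, termVal_lt_termVal_iff r hw, not_lt]

theorem coeff_lt_ne (ω : GMO C) (f : LaurentTate K r) {w : Fin n → ℤ} (hw : w ≠ lm ω f) :
    (lt ω f).coeff w = 0 := by
  rw [lt, LaurentTate.coeff_term, Pi.single_eq_of_ne hw]

theorem coeff_lt_lm (ω : GMO C) (f : LaurentTate K r) : (lt ω f).coeff (lm ω f) = lc ω f := by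
  rw [lt, LaurentTate.coeff_term, Pi.single_eq_same]

theorem tn_term_le {a : K} {t : Fin n → ℤ} {b : ℝ} (h : tn r a t ≤ b) (u : Fin n → ℤ) :
    tn r ((LaurentTate.term r a t).coeff u) u ≤ b := by
  by_cases hu : u = t
  · rwa [hu, LaurentTate.coeff_term, Pi.single_eq_same]
  · rw [LaurentTate.coeff_term, Pi.single_eq_of_ne hu, tn_zero]
    exact (tn_nonneg r _ _).trans h

theorem add_term (a b : K) (u : Fin n → ℤ) :
    LaurentTate.term r (a + b) u = LaurentTate.term r a u + LaurentTate.term r b u := by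
  ext w
  rw [LaurentTate.coeff_add, LaurentTate.coeff_term, LaurentTate.coeff_term,
    LaurentTate.coeff_term, Pi.single_add, Pi.add_apply]

theorem term_zero (u : Fin n → ℤ) : LaurentTate.term r (0 : K) u = 0 := by
  ext w
  rw [LaurentTate.coeff_term, Pi.single_zero]
  rfl

end Key

/-! ### Keys under sums and under multiplication by a term. -/

section KeyMul

variable {K : Type*} [NormedField K] {n : ℕ} {r : Fin n → ℚ} {I : Type*} [Finite I]
  {C : ConicDecomposition n I} [IsUltrametricDist K]

theorem key_add_le (ω : GMO C) (f g : LaurentTate K r) (w : Fin n → ℤ) :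
    key ω (f + g) w ≤ max (key ω f w) (key ω g w) := by
  unfold key
  rw [← mk_max]
  exact mk_mono_left ω w (tn_add_le r _ _ w)

theorem key_sub_le (ω : GMO C) (f g : LaurentTate K r) (w : Fin n → ℤ) :
    key ω (f - g) w ≤ max (key ω f w) (key ω g w) := by
  unfold key
  rw [← mk_max]
  exact mk_mono_left ω w (tn_sub_le r _ _ w)

theorem tn_term_mul (a : K) (t : Fin n → ℤ) (f : LaurentTate K r) (w : Fin n → ℤ) :
    tn r ((LaurentTate.term r a t * f).coeff w) w = tn r a t * tn r (f.coeff (w - t)) (w - t) := by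
  rw [LaurentTate.coeff_term_mul, ← tn_mul, add_sub_cancel]

theorem key_term_mul (ω : GMO C) (a : K) (t : Fin n → ℤ) (f : LaurentTate K r)
    (w : Fin n → ℤ) :
    key ω (LaurentTate.term r a t * f) w =
      mk ω (tn r a t * tn r (f.coeff (w - t)) (w - t)) w := by
  rw [key, tn_term_mul]

theorem term_mul_ne_zero {a : K} (ha : a ≠ 0) (t : Fin n → ℤ) {f : LaurentTate K r}
    (hf : f ≠ 0) : LaurentTate.term r a t * f ≠ 0 := by
  obtain ⟨u, hu⟩ := exists_coeff_ne_zero hf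
  intro h
  have := congrArg (fun g => LaurentTate.coeff g (u + t)) h
  simp only [LaurentTate.coeff_term_mul, add_sub_cancel_right, LaurentTate.coeff_zero] at this
  exact mul_ne_zero ha hu this

/-- Multiplication by `X^t` scales all absolute values by the same factor, so the dominant terms are
merely translated. This carries leading data from polynomials over to series. -/
theorem inr_term_mul (t : Fin n → ℤ) (f : LaurentTate K r) :
    inr (LaurentTate.term r 1 t * f) = AddMonoidAlgebra.single t 1 * inr f := by
  classical
  ext w
  rw [AddMonoidAlgebra.coeff_single_mul_apply, one_mul, coeff_inr, coeff_inr,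
    LaurentTate.coeff_term_mul, one_mul, neg_add_eq_sub]
  refine if_congr ?_ rfl rfl
  have e : ∀ u, tn r (1 * f.coeff (u - t)) u = tn r (1 : K) t * tn r (f.coeff (u - t)) (u - t) :=
    fun u => by rw [← tn_mul, add_sub_cancel]
  have hp : 0 < tn r (1 : K) t := (tn_pos_iff r).2 one_ne_zero
  simp only [LaurentTate.coeff_term_mul]
  rw [← (Equiv.addRight t).forall_congr_right]
  refine forall_congr' fun u => ?_
  have e2 := e w
  rw [one_mul] at e2
  rw [e, e2, Equiv.coe_addRight, add_sub_cancel_right, mul_le_mul_iff_right₀ hp]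

theorem lm_term_mul_smul (ω : GMO C) {a : K} (ha : a ≠ 0) (t : Fin n → ℤ)
    (f : LaurentTate K r) :
    lm ω (LaurentTate.term r a t * f) = lm ω (LaurentTate.term r 1 t * f) := by
  by_cases hf : f = 0
  · subst hf
    congr 1
    ext w
    simp [LaurentTate.coeff_term_mul]
  have h0 := lc_ne_zero ω (term_mul_ne_zero (one_ne_zero : (1 : K) ≠ 0) t hf)
  have h1 := key_le_leadKey ω (term_mul_ne_zero (one_ne_zero : (1 : K) ≠ 0) t hf)
  refine lm_eq_of_key_le ω ?_ fun w => ?_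
  · rw [lc, LaurentTate.coeff_term_mul] at h0
    rw [LaurentTate.coeff_term_mul]
    simpa [ha] using h0
  · have h2 := h1 w
    rw [leadKey, key_term_mul, key_term_mul, mk_le_mk] at h2
    rw [key_term_mul, key_term_mul, mk_le_mk]
    have ea : ∀ c : ℝ, tn r a t * c = ‖a‖ * (tn r (1 : K) t * c) := by intro c; simp [tn]; ring
    have hpa : 0 < ‖a‖ := norm_pos_iff.2 ha
    rw [ea, ea (tn r _ _)]
    rw [mul_lt_mul_iff_right₀ hpa, mul_right_inj' hpa.ne']
    exact h2

theorem gauss_term_mul (ω : GMO C) (a : K) (t : Fin n → ℤ) (f : LaurentTate K r) :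
    gauss ω (LaurentTate.term r a t * f) = tn r a t * gauss ω f := by
  refine le_antisymm ?_ ?_
  · rw [gauss, lc, tn_term_mul]
    exact mul_le_mul_of_nonneg_left (tn_le_gauss ω f _) (tn_nonneg r _ _)
  · have h := tn_le_gauss ω (LaurentTate.term r a t * f) (lm ω f + t)
    rwa [tn_term_mul, add_sub_cancel_right] at h

/-! ### The cones of a series -/

theorem mem_coneSet_iff (ω : GMO C) {i : I} {f : LaurentTate K r} {t : Fin n → ℤ} :
    t ∈ coneSet ω i f ↔ lm ω (LaurentTate.term r 1 t * f) ∈ C.cone i := by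
  rw [coneSet, polyT, Set.mem_ofPred_eq, lm, inr_term_mul]

/-- The leading monomial of any translate comes from one of the finitely many terms of maximal
absolute value. A shift sending all of these into the cone therefore works. -/
theorem coneSet_nonempty (ω : GMO C) (i : I) {f : LaurentTate K r} (hf : f ≠ 0) :
    (coneSet ω i f).Nonempty := by
  obtain ⟨t, ht⟩ := exists_add_mem_cone C i (finite_le_tn f (gauss_pos ω hf))
  refine ⟨t, (mem_coneSet_iff ω).2 ?_⟩
  have hne := gauss_pos ω (term_mul_ne_zero (one_ne_zero : (1 : K) ≠ 0) t hf)
  have h := gauss_term_mul ω (1 : K) t f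
  set w := lm ω (LaurentTate.term r (1 : K) t * f) with hw
  rw [gauss, lc, tn_term_mul, ← hw] at h
  have h2 := ht (w - t) (mul_left_cancel₀ ((tn_pos_iff r).2 one_ne_zero).ne' h).ge
  rwa [add_sub_cancel] at h2

/-- If `f` has all its keys below `(b, v)` with `v` in a cone, then multiplying by a term
of the same cone preserves this. -/
theorem key_term_mul_lt (ω : GMO C) {i : I} {a : K} (ha : a ≠ 0) {t v : Fin n → ℤ}
    (ht : t ∈ C.cone i) (hv : v ∈ C.cone i) {f : LaurentTate K r} {b : ℝ} {w : Fin n → ℤ}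
    (h : key ω f w < mk ω b v) :
    key ω (LaurentTate.term r a t * f) (w + t) < mk ω (tn r a t * b) (v + t) := by
  rw [key_term_mul, add_sub_cancel_right]
  rw [key, mk_lt_mk] at h
  have hp : 0 < tn r a t := (tn_pos_iff r).2 ha
  rw [mk_lt_mk, mul_lt_mul_iff_right₀ hp, mul_right_inj' hp.ne']
  exact h.imp id fun h => ⟨h.1, mon_add_lt ω hv ht h.2⟩

/-- The order is compatible with translation only when the larger monomial and the shift share a
cone. It suffices that the leading monomial does, since every other key is compared with that one.
-/
theorem lm_term_mul_of_mem (ω : GMO C) {i : I} {t : Fin n → ℤ} (ht : t ∈ C.cone i)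
    {f : LaurentTate K r} (hf : f ≠ 0) (hlm : lm ω f ∈ C.cone i) :
    lm ω (LaurentTate.term r 1 t * f) = lm ω f + t := by
  have h0 : (LaurentTate.term r 1 t * f).coeff (lm ω f + t) ≠ 0 := by
    rw [LaurentTate.coeff_term_mul, add_sub_cancel_right, one_mul]
    exact lc_ne_zero ω hf
  refine lm_eq_of_key_le ω h0 fun w => ?_
  obtain ⟨u, rfl⟩ : ∃ u, w = u + t := ⟨w - t, by abel⟩
  rcases (key_le_leadKey ω hf u).lt_or_eq with h | h
  · have := key_term_mul_lt ω (one_ne_zero : (1 : K) ≠ 0) ht hlm (leadKey_eq ω f ▸ h)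
    rw [key_term_mul ω _ _ _ (lm ω f + t), add_sub_cancel_right]
    exact this.le
  · rw [(mk_injective ω h).2]

theorem term_mul_term_mul (a b : K) (s t : Fin n → ℤ) (f : LaurentTate K r) :
    LaurentTate.term r a s * (LaurentTate.term r b t * f) =
      LaurentTate.term r (a * b) (s + t) * f := by
  ext w
  simp only [LaurentTate.coeff_term_mul]
  rw [mul_assoc, show w - s - t = w - (s + t) by abel]

theorem add_mem_coneSet (ω : GMO C) {i : I} {f : LaurentTate K r} (hf : f ≠ 0)
    {s t : Fin n → ℤ} (hs : s ∈ C.cone i) (ht : t ∈ coneSet ω i f) :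
    lm ω (LaurentTate.term r 1 (s + t) * f) = lm ω (LaurentTate.term r 1 t * f) + s := by
  rw [mem_coneSet_iff] at ht
  have h := lm_term_mul_of_mem ω hs (term_mul_ne_zero (one_ne_zero : (1 : K) ≠ 0) t hf) ht
  rwa [term_mul_term_mul, one_mul] at h

/-- This makes `lmi` independent of the chosen shift: two elements of `coneSet` have a common
translate by elements of the cone, where both leading monomials can be computed. -/
theorem lm_sub_eq (ω : GMO C) {i : I} {f : LaurentTate K r} (hf : f ≠ 0)
    {s t : Fin n → ℤ} (hs : s ∈ coneSet ω i f) (ht : t ∈ coneSet ω i f) :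
    lm ω (LaurentTate.term r 1 s * f) - s = lm ω (LaurentTate.term r 1 t * f) - t := by
  obtain ⟨x, hx, y, hy, e⟩ := exists_sub_mem_cone C i (s - t)
  have e' : y + s = x + t := by
    rw [sub_eq_sub_iff_add_eq_add] at e
    rw [add_comm, e]
  have h1 := add_mem_coneSet ω hf hy hs
  have h2 := add_mem_coneSet ω hf hx ht
  rw [e'] at h1
  rw [h1] at h2
  rw [sub_eq_sub_iff_add_eq_add]
  have h3 : lm ω (LaurentTate.term r 1 s * f) + t + (x + y) =
      lm ω (LaurentTate.term r 1 t * f) + s + (x + y) := by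
    calc _ = (lm ω (LaurentTate.term r 1 s * f) + y) + (x + t) := by abel
      _ = (lm ω (LaurentTate.term r 1 t * f) + x) + (y + s) := by rw [h2, e']
      _ = _ := by abel
  exact add_right_cancel h3

theorem lm_eq_lmi_add (ω : GMO C) {i : I} {f : LaurentTate K r} (hf : f ≠ 0)
    {t : Fin n → ℤ} (ht : t ∈ coneSet ω i f) :
    lm ω (LaurentTate.term r 1 t * f) = lmi ω i f + t := by
  have h : ∃ t, t ∈ polyT ω i (inr f) := ⟨t, ht⟩
  have h1 := lm_sub_eq ω hf ht (show h.choose ∈ coneSet ω i f from h.choose_spec)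
  rw [lmi, polyLMi, dif_pos h, ← inr_term_mul]
  exact sub_eq_iff_eq_add.1 h1

/-- A description free of `lmi`: only translates whose leading monomial falls in the cone matter. -/
theorem mem_leadSet_iff (ω : GMO C) {i : I} {f : LaurentTate K r} (hf : f ≠ 0)
    {v : Fin n → ℤ} : v ∈ leadSet ω i f ↔
      v ∈ C.cone i ∧ ∃ t, lm ω (LaurentTate.term r 1 t * f) = v := by
  constructor
  · rintro ⟨t, ht, rfl⟩
    rw [← lm_eq_lmi_add ω hf ht]
    exact ⟨(mem_coneSet_iff ω).1 ht, t, rfl⟩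
  · rintro ⟨hv, t, rfl⟩
    have ht := (mem_coneSet_iff ω).2 hv
    exact ⟨t, ht, lm_eq_lmi_add ω hf ht⟩

theorem lm_term_sub_lmi (ω : GMO C) {i : I} {f : LaurentTate K r} (hf : f ≠ 0)
    {v : Fin n → ℤ} (hv : v ∈ leadSet ω i f) :
    lm ω (LaurentTate.term r 1 (v - lmi ω i f) * f) = v := by
  obtain ⟨t, ht, rfl⟩ := hv
  rw [add_sub_cancel_left, lm_eq_lmi_add ω hf ht]

theorem eq_sub_lmi (ω : GMO C) {i : I} {f : LaurentTate K r} (hf : f ≠ 0)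
    {t : Fin n → ℤ} (h : lm ω (LaurentTate.term r 1 t * f) ∈ C.cone i) :
    t = lm ω (LaurentTate.term r 1 t * f) - lmi ω i f := by
  rw [lm_eq_lmi_add ω hf ((mem_coneSet_iff ω).2 h), add_sub_cancel_left]

/-- The monomial `lmi` is the position of the leading term of a translate, and translation preserves
ratios of absolute values, so the maximum is attained there. -/
theorem tn_lci (ω : GMO C) {i : I} {f : LaurentTate K r}
    {v : Fin n → ℤ} (h : lm ω (LaurentTate.term r 1 (v - lmi ω i f) * f) = v) :
    tn r (lci ω i f) (lmi ω i f) = gauss ω f := by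
  have h1 := gauss_term_mul ω (1 : K) (v - lmi ω i f) f
  rw [gauss, lc, tn_term_mul, h, sub_sub_cancel] at h1
  exact mul_left_cancel₀ ((tn_pos_iff r).2 one_ne_zero).ne' h1

theorem lci_ne_zero (ω : GMO C) {i : I} {f : LaurentTate K r} (hf : f ≠ 0)
    {v : Fin n → ℤ} (h : lm ω (LaurentTate.term r 1 (v - lmi ω i f) * f) = v) :
    lci ω i f ≠ 0 := by
  rw [← tn_pos_iff r (u := lmi ω i f), tn_lci ω h]
  exact gauss_pos ω hf

end KeyMul

/-! ### Sets of absolute values that accumulate only at zero -/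

/-- A set of reals with finitely many elements above each positive bound. -/
def LocFin (S : Set ℝ) : Prop := ∀ b > 0, {x ∈ S | b < x}.Finite

theorem LocFin.iUnion {ι : Type*} [Finite ι] {S : ι → Set ℝ} (h : ∀ i, LocFin (S i)) :
    LocFin (⋃ i, S i) := by
  intro b hb
  refine (Set.finite_iUnion fun i => h i b hb).subset ?_
  rintro x ⟨hx, hbx⟩
  obtain ⟨i, hi⟩ := Set.mem_iUnion.1 hx
  exact Set.mem_iUnion.2 ⟨i, hi, hbx⟩

theorem LocFin.insert {S : Set ℝ} (h : LocFin S) (a : ℝ) : LocFin (insert a S) := by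
  intro b hb
  refine ((h b hb).insert a).subset ?_
  rintro x ⟨rfl | hx, hbx⟩
  · exact Set.mem_insert _ _
  · exact Set.mem_insert_of_mem _ ⟨hx, hbx⟩

theorem LocFin.exists_bound {S : Set ℝ} (h : LocFin S) : ∃ M > 0, ∀ x ∈ S, x ≤ M := by
  obtain ⟨M, hM⟩ := (h 1 one_pos).bddAbove
  refine ⟨max M 1, by positivity, fun x hx => ?_⟩
  by_cases h1 : 1 < x
  · exact (hM ⟨hx, h1⟩).trans (le_max_left _ _)
  · exact (not_lt.1 h1).trans (le_max_right _ _)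

theorem LocFin.exists_gap {S : Set ℝ} (h : LocFin S) :
    ∃ δ, 0 < δ ∧ δ < 1 ∧ ∀ x ∈ S, x < 1 → x ≤ δ := by
  have hf : {x ∈ S | 1 / 2 < x ∧ x < 1}.Finite :=
    (h (1 / 2) (by norm_num)).subset fun x hx => ⟨hx.1, hx.2.1⟩
  rcases Set.eq_empty_or_nonempty {x ∈ S | 1 / 2 < x ∧ x < 1} with he | hne
  · refine ⟨1 / 2, by norm_num, by norm_num, fun x hx hx1 => ?_⟩
    by_contra hlt
    exact he.subset ⟨hx, not_le.1 hlt, hx1⟩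
  · obtain ⟨δ, hδ, hmax⟩ := Set.exists_max_image _ id hf hne
    refine ⟨δ, by linarith [hδ.2.1], hδ.2.2, fun x hx hx1 => ?_⟩
    by_cases h2 : 1 / 2 < x
    · exact hmax x ⟨hx, h2, hx1⟩
    · exact (not_lt.1 h2).trans hδ.2.1.le

/-- The closure of `E` under multiplication by the elements of `S`. -/
inductive MulClosure (E S : Set ℝ) : ℝ → Prop
  | base {x : ℝ} : x ∈ E → MulClosure E S x
  | mul {x s : ℝ} : MulClosure E S x → s ∈ S → MulClosure E S (x * s)

/-- Factors equal to one can be discarded, so an element outside `E` has a last factor that really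
decreases it. -/
theorem MulClosure.cases_lt_one {E S : Set ℝ} (hS : ∀ s ∈ S, s ≤ 1) {x : ℝ}
    (hx : MulClosure E S x) :
    x ∈ E ∨ ∃ y s, MulClosure E S y ∧ s ∈ S ∧ s < 1 ∧ x = y * s := by
  induction hx with
  | base h => exact Or.inl h
  | @mul x s hx hs ih =>
    rcases (hS s hs).lt_or_eq with h | rfl
    · exact Or.inr ⟨x, s, hx, hs, h, rfl⟩
    · rwa [mul_one]

/-- Factors below one are at most some `δ < 1`. Hence an element above `M δ^(k+1)` is in `E₀` or is
a product `y * s` with `y > M δ^k` and `s > δ^(k+1)`, which leaves finitely many choices by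
induction on `k`. -/
theorem exists_locFin_closed {E₀ S : Set ℝ} (hE : LocFin E₀) (hE0 : ∀ x ∈ E₀, 0 < x)
    (hS : LocFin S) (hS0 : ∀ s ∈ S, 0 < s) (hS1 : ∀ s ∈ S, s ≤ 1) :
    ∃ E : Set ℝ, E₀ ⊆ E ∧ LocFin E ∧ ∀ x ∈ E, ∀ s ∈ S, x * s ∈ E := by
  obtain ⟨M, hM, hEM⟩ := hE.exists_bound
  obtain ⟨δ, hδ0, hδ1, hδ⟩ := hS.exists_gap
  have hpos : ∀ x, MulClosure E₀ S x → 0 < x := by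
    intro x hx
    induction hx with
    | base h => exact hE0 _ h
    | mul _ hs ih => exact mul_pos ih (hS0 _ hs)
  have hle : ∀ x, MulClosure E₀ S x → x ≤ M := by
    intro x hx
    induction hx with
    | base h => exact hEM _ h
    | mul hx hs ih => exact (mul_le_of_le_one_right (hpos _ hx).le (hS1 _ hs)).trans ih
  have key : ∀ k : ℕ, {x | MulClosure E₀ S x ∧ M * δ ^ k < x}.Finite := by
    intro k
    induction k with
    | zero =>
      refine Set.finite_empty.subset ?_
      rintro x ⟨hx, h⟩
      rw [pow_zero, mul_one] at h
      exact absurd (hle x hx) (not_le.2 h)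
    | succ k ih =>
      refine ((hE (M * δ ^ (k + 1)) (by positivity)).union
        (ih.image2 (· * ·) (hS (δ ^ (k + 1)) (by positivity)))).subset ?_
      rintro x ⟨hx, h⟩
      rcases hx.cases_lt_one hS1 with hx | ⟨y, s, hy, hs, hs1, rfl⟩
      · exact Or.inl ⟨hx, h⟩
      · refine Or.inr ⟨y, ⟨hy, ?_⟩, s, ⟨hs, ?_⟩, rfl⟩
        · have h1 : y * s ≤ y * δ := mul_le_mul_of_nonneg_left (hδ s hs hs1) (hpos y hy).le
          rw [pow_succ, ← mul_assoc] at h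
          exact lt_of_mul_lt_mul_right (h.trans_le h1) hδ0.le
        · have h1 : y * s ≤ M * s := mul_le_mul_of_nonneg_right (hle y hy) (hS0 s hs).le
          exact lt_of_mul_lt_mul_left (h.trans_le h1) hM.le
  refine ⟨{x | MulClosure E₀ S x}, fun x hx => .base hx, fun b hb => ?_,
    fun x hx s hs => .mul hx hs⟩
  obtain ⟨k, hk⟩ := exists_pow_lt_of_lt_one (div_pos hb hM) hδ1
  rw [lt_div_iff₀ hM, mul_comm] at hk
  exact (key k).subset fun x hx => ⟨hx.1, hk.trans hx.2⟩

theorem wellFounded_lex {E : Set ℝ} (hE : LocFin E) {b : ℝ} (hb : 0 < b) {n : ℕ} {I : Type*}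
    [Finite I] {C : ConicDecomposition n I} (ω : GMO C) :
    {κ : ℝ ×ₗ Mon ω | (ofLex κ).1 ∈ E ∧ b ≤ (ofLex κ).1}.WellFoundedOn (· < ·) := by
  -- Local finiteness is stated with a strict bound; halving `b` makes room for `b ≤ x`. The
  -- lexicographic product of the finite `F` with the well-ordered monomials is well-founded.
  let F : Set ℝ := {x ∈ E | b / 2 < x}
  have hF : Finite F := hE (b / 2) (by positivity)
  let φ : F ×ₗ Mon ω → ℝ ×ₗ Mon ω := fun p => toLex ((ofLex p).1.1, (ofLex p).2)
  have hwf : WellFounded ((· < ·) : F ×ₗ Mon ω → F ×ₗ Mon ω → Prop) := wellFounded_lt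
  rw [Set.wellFoundedOn_iff_no_descending_seq]
  rintro f hf
  let g : ℕ → F ×ₗ Mon ω := fun k => toLex
    (⟨(ofLex (f k)).1, (hf k).1, by have := (hf k).2; linarith⟩, (ofLex (f k)).2)
  have hg : ∀ k, g (k + 1) < g k := by
    intro k
    have h : f (k + 1) < f k := f.map_rel_iff.2 (Nat.lt_succ_self k)
    rw [Prod.Lex.lt_iff] at h ⊢
    exact h.imp id fun h => ⟨Subtype.ext h.1, h.2⟩
  exact (RelEmbedding.not_wellFounded (RelEmbedding.natGT g hg)) hwf

/-! ### Discreteness -/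

section Discrete

variable {K : Type*} [NormedField K]

theorem exists_uniformizer_norm (hK : IsDiscretelyValued K) :
    ∃ π : ℝ, 0 < π ∧ π < 1 ∧ ∀ x y : K, x ≠ 0 → ‖x‖ ≤ ‖y‖ → ∃ k : ℕ, ‖x‖ = ‖y‖ * π ^ k := by
  obtain ⟨ϖ, h0, h1, h2⟩ := hK
  have hval : ∀ x : K, x ≠ 0 → (0 < val x ↔ ‖x‖ < 1) := by
    intro x hx
    rw [val, if_neg hx, ← WithTop.coe_zero, WithTop.coe_lt_coe, neg_pos,
      Real.log_neg_iff (norm_pos_iff.2 hx)]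
  have hval' : ∀ x : K, x ≠ 0 → (0 ≤ val x ↔ ‖x‖ ≤ 1) := by
    intro x hx
    rw [val, if_neg hx, ← WithTop.coe_zero, WithTop.coe_le_coe, neg_nonneg,
      Real.log_nonpos_iff (norm_nonneg x)]
  have hπ0 : 0 < ‖ϖ‖ := norm_pos_iff.2 h0
  have hπ1 : ‖ϖ‖ < 1 := (hval ϖ h0).1 h1
  -- The bound `N` limits how often `ϖ` can be divided out before the norm becomes one.
  have key : ∀ N : ℕ, ∀ z : K, ‖ϖ‖ ^ N < ‖z‖ → ‖z‖ ≤ 1 → ∃ k : ℕ, ‖z‖ = ‖ϖ‖ ^ k := by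
    intro N
    induction N with
    | zero => intro z hz hz1; rw [pow_zero] at hz; exact absurd hz1 (not_le.2 hz)
    | succ N ih =>
      intro z hz hz1
      rcases hz1.lt_or_eq with hz1 | hz1
      · have hz0 : z ≠ 0 := norm_pos_iff.1 ((pow_pos hπ0 _).trans hz)
        obtain ⟨y, hy, rfl⟩ := h2 z ((hval z hz0).2 hz1)
        rw [norm_mul, pow_succ] at hz
        obtain ⟨k, hk⟩ := ih y (lt_of_mul_lt_mul_right hz hπ0.le)
          ((hval' y (left_ne_zero_of_mul hz0)).1 hy)
        exact ⟨k + 1, by rw [norm_mul, hk, pow_succ]⟩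
      · exact ⟨0, by rw [hz1, pow_zero]⟩
  refine ⟨‖ϖ‖, hπ0, hπ1, fun x y hx hxy => ?_⟩
  have hx0 : 0 < ‖x‖ := norm_pos_iff.2 hx
  have hy0 : 0 < ‖y‖ := hx0.trans_le hxy
  have hz : 0 < ‖x / y‖ := by rw [norm_div]; positivity
  obtain ⟨N, hN⟩ := exists_pow_lt_of_lt_one hz hπ1
  obtain ⟨k, hk⟩ := key N (x / y) hN (by rw [norm_div]; exact (div_le_one hy0).2 hxy)
  refine ⟨k, ?_⟩
  rw [← hk, norm_div, mul_div_cancel₀ _ hy0.ne']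

/-- `π` generates the ratios of absolute values of `K` at most one. -/
def IsUniformizerNorm (K : Type*) [NormedField K] (π : ℝ) : Prop :=
  0 < π ∧ π < 1 ∧ ∀ x y : K, x ≠ 0 → ‖x‖ ≤ ‖y‖ → ∃ k : ℕ, ‖x‖ = ‖y‖ * π ^ k

variable {n : ℕ} (r : Fin n → ℚ)

/-- By discreteness a smaller norm is a larger one times a power of `π`, so closure under `π` gives
closure under decrease of the coefficient. The weight `c` will be a Gauss norm. -/
theorem tn_mem_of_le {π : ℝ} (hπ : IsUniformizerNorm K π) {E : Set ℝ}
    (hE : ∀ x ∈ E, x * π ∈ E) {a b : K} {u : Fin n → ℤ} {c : ℝ} (ha : a ≠ 0) (hab : ‖a‖ ≤ ‖b‖)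
    (hb : tn r b u * c ∈ E) : tn r a u * c ∈ E := by
  obtain ⟨k, hk⟩ := hπ.2.2 a b ha hab
  have h : ∀ k : ℕ, tn r b u * c * π ^ k ∈ E := by
    intro k
    induction k with
    | zero => simpa using hb
    | succ k ih => rw [pow_succ, ← mul_assoc]; exact hE _ ih
  have e : tn r a u * c = tn r b u * c * π ^ k := by rw [tn, tn, hk]; ring
  rw [e]
  exact h k

theorem tn_add_mem [IsUltrametricDist K] {π : ℝ} (hπ : IsUniformizerNorm K π) {E : Set ℝ}
    (hE : ∀ x ∈ E, x * π ∈ E) {a b : K} {u : Fin n → ℤ} {c : ℝ} (ha : a ≠ 0 → tn r a u * c ∈ E)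
    (hb : b ≠ 0 → tn r b u * c ∈ E) (hab : a + b ≠ 0) : tn r (a + b) u * c ∈ E := by
  have hpos := norm_pos_iff.2 hab
  rcases le_max_iff.1 (IsUltrametricDist.norm_add_le_max a b) with h | h
  · exact tn_mem_of_le r hπ hE hab h (ha (norm_pos_iff.1 (hpos.trans_le h)))
  · exact tn_mem_of_le r hπ hE hab h (hb (norm_pos_iff.1 (hpos.trans_le h)))

theorem locFin_tn {r : Fin n → ℚ} (f : LaurentTate K r) {c : ℝ} (hc : 0 < c) :
    LocFin {x | ∃ u, f.coeff u ≠ 0 ∧ x = tn r (f.coeff u) u * c} := by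
  intro b hb
  refine ((finite_le_tn f (div_pos hb hc)).image fun u => tn r (f.coeff u) u * c).subset ?_
  rintro _ ⟨⟨u, -, rfl⟩, h⟩
  exact ⟨u, (div_le_iff₀ hc).2 h.le, rfl⟩

end Discrete

/-! ### Infinite sums and limits -/

section Limits

variable {K : Type*} [NormedField K] {n : ℕ} {r : Fin n → ℚ} [IsUltrametricDist K]

/-- The ultrametric inequality bounds an infinite sum by the supremum of its terms, and that
supremum is attained because the terms tend to zero. -/
theorem exists_norm_tsum_le {ι : Type*} {a : ι → K}
    (ha : Filter.Tendsto a Filter.cofinite (𝓝 0)) (h : ∑' i, a i ≠ 0) :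
    ∃ i, ‖∑' i, a i‖ ≤ ‖a i‖ := by
  by_contra! hlt
  set b := ‖∑' i, a i‖
  have hb : 0 < b := norm_pos_iff.2 h
  -- Any threshold strictly between `0` and `b` would do: if no term reaches it the sum is too
  -- small, and otherwise the largest of the finitely many terms reaching it bounds the sum.
  have hfin := (tendsto_zero_iff_norm_tendsto_zero.1 ha).eventually (gt_mem_nhds (half_pos hb))
  rw [Filter.eventually_cofinite] at hfin
  rcases Set.eq_empty_or_nonempty {i | ¬‖a i‖ < b / 2} with he | hne
  · have h1 : b ≤ b / 2 := IsUltrametricDist.norm_tsum_le_of_forall_le_of_nonneg (by positivity)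
      fun i => by
        by_contra hi
        exact he.subset (show i ∈ {i | ¬‖a i‖ < b / 2} from fun h => hi h.le)
    linarith
  · obtain ⟨i, hi, hmax⟩ := Set.exists_max_image _ (fun i => ‖a i‖) hfin hne
    have h1 : b ≤ ‖a i‖ := IsUltrametricDist.norm_tsum_le_of_forall_le_of_nonneg (norm_nonneg _)
      fun j => by
        by_cases hj : ‖a j‖ < b / 2
        · exact hj.le.trans (not_lt.1 hi)
        · exact hmax j hj
    exact absurd (hlt i) (not_lt.2 h1)

variable [CompleteSpace K]

theorem convergesTo_iff {x : ℕ → LaurentTate K r} {y : LaurentTate K r} :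
    ConvergesTo x y ↔ ∀ ε > 0, ∃ N, ∀ k ≥ N, ∀ u, tn r ((x k - y).coeff u) u ≤ ε := by
  constructor
  · intro h ε hε
    obtain ⟨N, hN⟩ := h (-Real.log ε)
    refine ⟨N, fun k hk u => ?_⟩
    have := (le_termVal_iff r).1 (hN k hk u)
    rwa [neg_neg, Real.exp_log hε] at this
  · intro h B
    obtain ⟨N, hN⟩ := h (Real.exp (-B)) (Real.exp_pos _)
    exact ⟨N, fun k hk u => (le_termVal_iff r).2 (hN k hk u)⟩

theorem ConvergesTo.unique {x : ℕ → LaurentTate K r} {y z : LaurentTate K r}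
    (hy : ConvergesTo x y) (hz : ConvergesTo x z) : y = z := by
  rw [convergesTo_iff] at hy hz
  rw [← sub_eq_zero]
  ext u
  rw [LaurentTate.coeff_zero, ← tn_eq_zero_iff r (u := u)]
  refine le_antisymm (le_of_forall_pos_le_add fun ε hε => ?_) (tn_nonneg r _ _)
  obtain ⟨N, hN⟩ := hy ε hε
  obtain ⟨M, hM⟩ := hz ε hε
  have h1 := hN (max N M) (le_max_left _ _) u
  have h2 := hM (max N M) (le_max_right _ _) u
  have h3 := tn_sub_le r ((x (max N M) - z).coeff u) ((x (max N M) - y).coeff u) u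
  have e : (x (max N M) - z).coeff u - (x (max N M) - y).coeff u = (y - z).coeff u := by
    simp only [LaurentTate.coeff_sub]; ring
  rw [e] at h3
  rw [zero_add]
  exact h3.trans (max_le h2 h1)

theorem ConvergesTo.const (y : LaurentTate K r) : ConvergesTo (fun _ => y) y := by
  rw [convergesTo_iff]
  exact fun ε hε => ⟨0, fun k _ u => by simpa using hε.le⟩

theorem ConvergesTo.add {x x' : ℕ → LaurentTate K r} {y y' : LaurentTate K r}
    (h : ConvergesTo x y) (h' : ConvergesTo x' y') :
    ConvergesTo (fun k => x k + x' k) (y + y') := by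
  rw [convergesTo_iff] at *
  intro ε hε
  obtain ⟨N, hN⟩ := h ε hε
  obtain ⟨M, hM⟩ := h' ε hε
  refine ⟨max N M, fun k hk u => ?_⟩
  have h3 := tn_add_le r ((x k - y).coeff u) ((x' k - y').coeff u) u
  rw [show (x k + x' k - (y + y')).coeff u = (x k - y).coeff u + (x' k - y').coeff u by
    simp only [LaurentTate.coeff_sub, LaurentTate.coeff_add]; ring]
  exact h3.trans (max_le (hN k (le_of_max_le_left hk) u) (hM k (le_of_max_le_right hk) u))

theorem ConvergesTo.sum {ι : Type*} (s : Finset ι) {x : ι → ℕ → LaurentTate K r}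
    {y : ι → LaurentTate K r} (h : ∀ i ∈ s, ConvergesTo (x i) (y i)) :
    ConvergesTo (fun k => ∑ i ∈ s, x i k) (∑ i ∈ s, y i) := by
  classical
  induction s using Finset.induction_on with
  | empty => simpa using ConvergesTo.const 0
  | insert a s ha ih =>
    simp only [Finset.sum_insert ha]
    exact (h a (Finset.mem_insert_self a s)).add
      (ih fun i hi => h i (Finset.mem_insert_of_mem hi))

/-- A coefficient of a product is bounded by a single product of coefficients. -/
theorem exists_tn_mul_le (p g : LaurentTate K r) (w : Fin n → ℤ) (h : (p * g).coeff w ≠ 0) :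
    ∃ u, tn r ((p * g).coeff w) w ≤
      tn r ((LaurentTate.term r (p.coeff u) u * g).coeff w) w := by
  rw [LaurentTate.coeff_mul] at h ⊢
  obtain ⟨u, hu⟩ := exists_norm_tsum_le
    (LaurentTate.summable_conv p g w).tendsto_cofinite_zero h
  refine ⟨u, ?_⟩
  rw [LaurentTate.coeff_term_mul]
  exact (tn_le_tn_iff r).2 hu

theorem tn_mul_le {p g : LaurentTate K r} {A B : ℝ} (hA : ∀ u, tn r (p.coeff u) u ≤ A)
    (hB : ∀ u, tn r (g.coeff u) u ≤ B) (w : Fin n → ℤ) : tn r ((p * g).coeff w) w ≤ A * B := by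
  have hA0 : 0 ≤ A := (tn_nonneg r _ _).trans (hA 0)
  have hB0 : 0 ≤ B := (tn_nonneg r _ _).trans (hB 0)
  by_cases h : (p * g).coeff w = 0
  · rw [h, tn_zero]
    positivity
  · obtain ⟨u, hu⟩ := exists_tn_mul_le p g w h
    rw [tn_term_mul] at hu
    exact hu.trans (mul_le_mul (hA _) (hB _) (tn_nonneg r _ _) hA0)

theorem ConvergesTo.mul_right {x : ℕ → LaurentTate K r} {y : LaurentTate K r}
    (h : ConvergesTo x y) (g : LaurentTate K r) : ConvergesTo (fun k => x k * g) (y * g) := by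
  obtain ⟨M, hM0, hM⟩ := LaurentTate.exists_bound g
  rw [convergesTo_iff] at *
  intro ε hε
  obtain ⟨N, hN⟩ := h (ε / (M + 1)) (by positivity)
  refine ⟨N, fun k hk u => ?_⟩
  rw [← sub_mul]
  refine (tn_mul_le (B := M + 1) (hN k hk) (fun u => (hM u).trans (by linarith)) u).trans ?_
  rw [div_mul_cancel₀ _ (by positivity)]

/-- In the ultrametric setting small increments already give a uniform Cauchy condition. The
coefficientwise limit satisfies the decay condition because its large coefficients are also large in
a late `x N`. -/
theorem exists_convergesTo {x : ℕ → LaurentTate K r}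
    (h : ∀ ε > 0, ∃ N, ∀ k ≥ N, ∀ u, tn r ((x (k + 1) - x k).coeff u) u ≤ ε) :
    ∃ y, ConvergesTo x y := by
  have hcauchy : ∀ ε > 0, ∃ N, ∀ k ≥ N, ∀ l ≥ k, ∀ u,
      tn r ((x l).coeff u - (x k).coeff u) u ≤ ε := by
    intro ε hε
    obtain ⟨N, hN⟩ := h ε hε
    refine ⟨N, fun k hk l hl u => ?_⟩
    induction l, hl using Nat.le_induction with
    | base => simpa using hε.le
    | succ l hl ih =>
      have h1 := tn_add_le r ((x (l + 1) - x l).coeff u) ((x l).coeff u - (x k).coeff u) u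
      rw [LaurentTate.coeff_sub, sub_add_sub_cancel] at h1
      exact h1.trans (max_le (hN l (hk.trans hl) u) ih)
  have hlim : ∀ u, ∃ a, Filter.Tendsto (fun k => (x k).coeff u) Filter.atTop (𝓝 a) := by
    intro u
    refine cauchySeq_tendsto_of_complete (Metric.cauchySeq_iff'.2 fun ε hε => ?_)
    obtain ⟨N, hN⟩ := hcauchy (ε / 2 * Real.exp (dot r u)) (by positivity)
    refine ⟨N, fun l hl => ?_⟩
    have := le_of_mul_le_mul_right (hN N le_rfl l hl u) (Real.exp_pos _)
    rw [dist_eq_norm]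
    linarith
  choose y hy using hlim
  have hxy : ∀ ε > 0, ∃ N, ∀ k ≥ N, ∀ u, tn r ((x k).coeff u - y u) u ≤ ε := by
    intro ε hε
    obtain ⟨N, hN⟩ := hcauchy ε hε
    refine ⟨N, fun k hk u => ?_⟩
    have ht : Filter.Tendsto (fun l => tn r ((x l).coeff u - (x k).coeff u) u) Filter.atTop
        (𝓝 (tn r (y u - (x k).coeff u) u)) :=
      (((hy u).sub_const _).norm).mul_const _
    have := le_of_tendsto ht (Filter.eventually_atTop.2 ⟨k, fun l hl => hN k hk l hl u⟩)
    rwa [← neg_sub, tn_neg] at this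
  refine ⟨⟨y, fun B => ?_⟩, convergesTo_iff.2 hxy⟩
  obtain ⟨N, hN⟩ := hxy (Real.exp (-B)) (Real.exp_pos _)
  refine ((x N).converges B).subset fun u hu => ?_
  rw [Set.mem_ofPred_eq, termVal_lt_iff] at hu ⊢
  by_contra hcon
  have h1 := tn_sub_le r ((x N).coeff u) ((x N).coeff u - y u) u
  rw [sub_sub_cancel] at h1
  exact absurd (h1.trans (max_le (not_lt.1 hcon) (hN N le_rfl u))) (not_le.2 hu)

end Limits

/-! ### The division algorithm -/

section Division

variable {K : Type*} [NormedField K] [IsUltrametricDist K] [CompleteSpace K] {n : ℕ}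
  {r : Fin n → ℚ} {I : Type*} [Finite I] {C : ConicDecomposition n I}

theorem exists_key_mul_le (ω : GMO C) (p g : LaurentTate K r) (w : Fin n → ℤ) :
    ∃ u, key ω (p * g) w ≤ key ω (LaurentTate.term r (p.coeff u) u * g) w := by
  by_cases h : (p * g).coeff w = 0
  · refine ⟨0, mk_mono_left ω w ?_⟩
    rw [h, tn_zero]
    exact tn_nonneg r _ _
  · obtain ⟨u, hu⟩ := exists_tn_mul_le p g w h
    exact ⟨u, mk_mono_left ω w hu⟩

/-- At `v` the coefficients cancel; elsewhere the bound cannot be attained, because a key remembers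
its monomial. -/
theorem key_sub_lt (ω : GMO C) {f g : LaurentTate K r} {v : Fin n → ℤ} {κ : ℝ ×ₗ Mon ω}
    (hf : ∀ w, key ω f w ≤ κ) (hg : ∀ w, key ω g w ≤ κ) (hκ : key ω f v = κ)
    (hv : f.coeff v = g.coeff v) (h0 : f.coeff v ≠ 0) (w : Fin n → ℤ) :
    key ω (f - g) w < κ := by
  by_cases hw : w = v
  · subst hw
    rw [← hκ, key, LaurentTate.coeff_sub, hv, sub_self, tn_zero, key, mk_lt_mk]
    exact Or.inl ((tn_pos_iff r).2 h0)
  · refine lt_of_le_of_ne ((key_sub_le ω f g w).trans (max_le (hf w) (hg w))) fun e => hw ?_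
    rw [← hκ] at e
    exact (mk_injective ω e).2

theorem key_zero_lt (ω : GMO C) {b : ℝ} (hb : 0 < b) (v w : Fin n → ℤ) :
    key ω (0 : LaurentTate K r) w < mk ω b v := by
  rw [key, LaurentTate.coeff_zero, tn_zero, mk_lt_mk]
  exact Or.inl hb

/-- The monomials reached by `Reducible` are those of the sets `leadSet`. -/
theorem reducible_of_mem_leadSet (ω : GMO C) {f g : LaurentTate K r} (hg : g ≠ 0) {i : I}
    (h : lm ω f ∈ leadSet ω i g) : Reducible ω f g i := lm_term_sub_lmi ω hg h

variable {m : ℕ} {h : Fin m → LaurentTate K r}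

/-- A step of the division subtracts from a nonzero dividend `a.f` a series `g` with the same
leading term, which is either a multiple of some `h j` or the leading term itself. -/
theorem divStep_cases (ω : GMO C) (hne : ∀ j, h j ≠ 0) {a b : DivState K r m}
    (hab : DivStep ω h a b) :
    (a.f = 0 ∧ b = a) ∨ a.f ≠ 0 ∧ ∃ g : LaurentTate K r, (∀ w, key ω g w ≤ leadKey ω a.f) ∧
      g.coeff (lm ω a.f) = lc ω a.f ∧ b.f = a.f - g ∧
      ((∃ j c t, g = LaurentTate.term r c t * h j ∧
        b.q = a.q + Pi.single j (LaurentTate.term r c t) ∧ b.s = a.s) ∨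
      ((¬ ∃ (i : I) (j : Fin m), Reducible ω a.f (h j) i) ∧
        g = lt ω a.f ∧ b.q = a.q ∧ b.s = a.s + lt ω a.f)) := by
  rcases hab with h1 | ⟨h0, i, j, hred, hf, hq, hs⟩ | ⟨h0, hred, hf, hq, hs⟩
  · exact Or.inl h1
  · refine Or.inr ⟨h0, _, ?_, ?_, hf, Or.inl ⟨j, _, _, rfl, hq, hs⟩⟩
    · have hl := lci_ne_zero ω (hne j) hred
      have hc : lc ω a.f / lci ω i (h j) ≠ 0 := div_ne_zero (lc_ne_zero ω h0) hl
      intro w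
      refine (key_le_leadKey ω (term_mul_ne_zero hc _ (hne j)) w).trans_eq ?_
      rw [leadKey, lm_term_mul_smul ω hc, show lm ω _ = lm ω a.f from hred, leadKey, key, key,
        LaurentTate.coeff_term_mul, sub_sub_cancel,
        show (h j).coeff (lmi ω i (h j)) = lci ω i (h j) from rfl, div_mul_cancel₀ _ hl]
      rfl
    · rw [LaurentTate.coeff_term_mul, sub_sub_cancel,
        show (h j).coeff (lmi ω i (h j)) = lci ω i (h j) from rfl,
        div_mul_cancel₀ _ (lci_ne_zero ω (hne j) hred)]
  · refine Or.inr ⟨h0, lt ω a.f, fun w => ?_, coeff_lt_lm ω a.f, hf,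
      Or.inr ⟨hred, rfl, hq, hs⟩⟩
    by_cases hw : w = lm ω a.f
    · subst hw
      rw [leadKey, key, coeff_lt_lm]
      exact le_rfl
    · rw [leadKey_eq, key, coeff_lt_ne ω _ hw, tn_zero, mk_le_mk]
      exact Or.inl (gauss_pos ω h0)

theorem key_divStep_lt (ω : GMO C) (hne : ∀ j, h j ≠ 0) {a b : DivState K r m}
    (hab : DivStep ω h a b) (h0 : a.f ≠ 0) (w : Fin n → ℤ) : key ω b.f w < leadKey ω a.f := by
  rcases divStep_cases ω hne hab with h1 | ⟨-, g, hg, hgc, hf, -⟩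
  · exact absurd h1.1 h0
  · rw [hf]
    exact key_sub_lt ω (key_le_leadKey ω h0) hg rfl hgc.symm (lc_ne_zero ω h0) w

theorem gauss_divStep_le (ω : GMO C) (hne : ∀ j, h j ≠ 0) {a b : DivState K r m}
    (hab : DivStep ω h a b) : gauss ω b.f ≤ gauss ω a.f := by
  by_cases h0 : a.f = 0
  · rcases divStep_cases ω hne hab with h1 | h1
    · rw [h1.2]
    · exact absurd h0 h1.1
  · exact fst_le_of_mk_le ω (key_divStep_lt ω hne hab h0 (lm ω b.f)).le

theorem divStep_invariant (ω : GMO C) (hne : ∀ j, h j ≠ 0) {a b : DivState K r m}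
    (hab : DivStep ω h a b) :
    b.f + ∑ j, b.q j * h j + b.s = a.f + ∑ j, a.q j * h j + a.s := by
  rcases divStep_cases ω hne hab with h1 | ⟨-, g, -, -, hf, ⟨j, c, t, hg, hq, hs⟩ | ⟨-, hg, hq, hs⟩⟩
  · rw [h1.2]
  · have e : ∑ l, (a.q + Pi.single j (LaurentTate.term r c t) : Fin m → LaurentTate K r) l * h l =
        ∑ l, a.q l * h l + LaurentTate.term r c t * h j := by
      simp [add_mul, Finset.sum_add_distrib, Pi.single_apply, ite_mul]
    rw [hf, hq, hs, e, hg]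
    abel
  · rw [hf, hq, hs, hg]
    abel

/-- The subtracted multiple of `h j` has the Gauss norm of the dividend, so its values are that norm
times normalized values of `h j`. The subtraction itself costs at most a power of `π`. -/
theorem values_divStep (ω : GMO C) (hne : ∀ j, h j ≠ 0) {π : ℝ} (hπ : IsUniformizerNorm K π)
    {E : Set ℝ} (hEπ : ∀ x ∈ E, x * π ∈ E)
    (hE : ∀ x ∈ E, ∀ j u, (h j).coeff u ≠ 0 →
      x * (tn r ((h j).coeff u) u * (gauss ω (h j))⁻¹) ∈ E)
    {a b : DivState K r m} (hab : DivStep ω h a b)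
    (ha : ∀ u, a.f.coeff u ≠ 0 → tn r (a.f.coeff u) u ∈ E) :
    ∀ u, b.f.coeff u ≠ 0 → tn r (b.f.coeff u) u ∈ E := by
  rcases divStep_cases ω hne hab with h1 | ⟨h0, g, hg, hgc, hf, hcase⟩
  · rwa [h1.2]
  have hgauss : gauss ω a.f ∈ E := ha _ (lc_ne_zero ω h0)
  have hgE : ∀ u, g.coeff u ≠ 0 → tn r (g.coeff u) u ∈ E := by
    rcases hcase with ⟨j, c, t, hgj, -, -⟩ | ⟨-, hgl, -, -⟩
    · intro u hu
      have hgg : gauss ω g = gauss ω a.f := by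
        refine le_antisymm (fst_le_of_mk_le ω (hg (lm ω g))) ?_
        have := tn_le_gauss ω g (lm ω a.f)
        rwa [hgc] at this
      rw [hgj, gauss_term_mul] at hgg
      rw [hgj, LaurentTate.coeff_term_mul] at hu
      have := hE _ hgauss j (u - t) (right_ne_zero_of_mul hu)
      rw [← hgg] at this
      rw [hgj, tn_term_mul]
      convert this using 1
      have := (gauss_pos ω (hne j)).ne'
      field_simp
    · intro u hu
      by_cases huv : u = lm ω a.f
      · rw [huv, hgc]
        exact hgauss
      · rw [hgl, coeff_lt_ne ω _ huv] at hu
        exact absurd rfl hu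
  intro u hu
  rw [hf, LaurentTate.coeff_sub, sub_eq_add_neg] at hu ⊢
  have := tn_add_mem r hπ hEπ (a := a.f.coeff u) (b := -g.coeff u) (u := u) (c := 1)
    (by simpa using ha u) (by simpa [tn_neg] using hgE u) hu
  rwa [mul_one] at this

/-- The dividends of an execution of the division algorithm tend to zero. -/
theorem tendsto_dividend (hK : IsDiscretelyValued K) (ω : GMO C) (hne : ∀ j, h j ≠ 0)
    {σ : ℕ → DivState K r m} (hσ : ∀ k, DivStep ω h (σ k) (σ (k + 1))) {ε : ℝ} (hε : 0 < ε) :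
    ∃ N, ∀ k ≥ N, gauss ω (σ k).f ≤ ε := by
  obtain ⟨π, hπ⟩ : ∃ π, IsUniformizerNorm K π := exists_uniformizer_norm hK
  have hanti : Antitone fun k => gauss ω (σ k).f :=
    antitone_nat_of_succ_le fun k => gauss_divStep_le ω hne (hσ k)
  by_contra! hcon
  have hlt : ∀ k, ε < gauss ω (σ k).f := by
    intro k
    obtain ⟨l, hl, h1⟩ := hcon k
    exact h1.trans_le (hanti hl)
  have hf0 : ∀ k, (σ k).f ≠ 0 := by
    intro k h0
    have := hlt k
    rw [h0, gauss_zero] at this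
    linarith
  -- The factors by which a division step can change absolute values: `π` for cancellation, and the
  -- normalized coefficients of the divisors for products.
  let S : Set ℝ := insert π (⋃ j, {x | ∃ u, (h j).coeff u ≠ 0 ∧
    x = tn r ((h j).coeff u) u * (gauss ω (h j))⁻¹})
  have hg : ∀ j, 0 < gauss ω (h j) := fun j => gauss_pos ω (hne j)
  have hS : LocFin S := (LocFin.iUnion fun j => locFin_tn (h j) (inv_pos.2 (hg j))).insert π
  have hS' : ∀ s ∈ S, 0 < s ∧ s ≤ 1 := by
    rintro s (rfl | hs)
    · exact ⟨hπ.1, hπ.2.1.le⟩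
    · obtain ⟨j, u, hu, rfl⟩ := Set.mem_iUnion.1 hs
      refine ⟨mul_pos ((tn_pos_iff r).2 hu) (inv_pos.2 (hg j)), ?_⟩
      rw [← div_eq_mul_inv, div_le_one (hg j)]
      exact tn_le_gauss ω (h j) u
  obtain ⟨E, hE₀, hE, hES⟩ := exists_locFin_closed (locFin_tn (σ 0).f one_pos)
    (by rintro _ ⟨u, hu, rfl⟩; rw [mul_one]; exact (tn_pos_iff r).2 hu) hS
    (fun s hs => (hS' s hs).1) (fun s hs => (hS' s hs).2)
  have hval : ∀ k, ∀ u, (σ k).f.coeff u ≠ 0 → tn r ((σ k).f.coeff u) u ∈ E := by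
    intro k
    induction k with
    | zero => exact fun u hu => hE₀ ⟨u, hu, (mul_one _).symm⟩
    | succ k ih =>
      exact values_divStep ω hne hπ (fun x hx => hES x hx π (Set.mem_insert _ _))
        (fun x hx j u hu => hES x hx _
          (Set.mem_insert_of_mem _ (Set.mem_iUnion.2 ⟨j, u, hu, rfl⟩))) (hσ k) ih
  -- If the Gauss norms stayed above `ε`, the leading keys would lie in a well-founded set and
  -- decrease strictly at each step.
  obtain ⟨⟨κ, hκ⟩, ⟨k, hk⟩, hmin⟩ := (wellFounded_lex hE hε ω).has_min
    {κ | ∃ k, κ.1 = leadKey ω (σ k).f}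
    ⟨⟨leadKey ω (σ 0).f, hval 0 _ (lc_ne_zero ω (hf0 0)), (hlt 0).le⟩, 0, rfl⟩
  refine hmin ⟨leadKey ω (σ (k + 1)).f, hval (k + 1) _ (lc_ne_zero ω (hf0 (k + 1))),
    (hlt (k + 1)).le⟩ ⟨k + 1, rfl⟩ ?_
  have := key_divStep_lt ω hne (hσ k) (hf0 k) (lm ω (σ (k + 1)).f)
  rw [← show κ = leadKey ω (σ k).f from hk] at this
  exact this

theorem convergesTo_dividend (hK : IsDiscretelyValued K) (ω : GMO C) (hne : ∀ j, h j ≠ 0)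
    {σ : ℕ → DivState K r m} (hσ : ∀ k, DivStep ω h (σ k) (σ (k + 1))) :
    ConvergesTo (fun k => (σ k).f) 0 := by
  rw [convergesTo_iff]
  intro ε hε
  obtain ⟨N, hN⟩ := tendsto_dividend hK ω hne hσ hε
  refine ⟨N, fun k hk u => ?_⟩
  rw [sub_zero]
  exact (tn_le_gauss ω _ u).trans (hN k hk)

theorem exists_divStep (ω : GMO C) (a : DivState K r m) : ∃ b, DivStep ω h a b := by
  by_cases h0 : a.f = 0
  · exact ⟨a, Or.inl ⟨h0, rfl⟩⟩
  by_cases hred : ∃ (i : I) (j : Fin m), Reducible ω a.f (h j) i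
  · obtain ⟨i, j, hij⟩ := hred
    exact ⟨⟨_, _, _⟩, Or.inr (Or.inl ⟨h0, i, j, hij, rfl, rfl, rfl⟩)⟩
  · exact ⟨⟨_, _, _⟩, Or.inr (Or.inr ⟨h0, hred, rfl, rfl, rfl⟩)⟩

theorem quotient_increment_le (ω : GMO C) (hne : ∀ j, h j ≠ 0) {a b : DivState K r m}
    (hab : DivStep ω h a b) (j : Fin m) (u : Fin n → ℤ) :
    tn r ((b.q j - a.q j).coeff u) u ≤ gauss ω a.f / gauss ω (h j) := by
  have hg := gauss_pos ω (hne j)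
  have h00 : 0 ≤ gauss ω a.f / gauss ω (h j) := div_nonneg (tn_nonneg r _ _) hg.le
  rcases divStep_cases ω hne hab with h1 |
    ⟨h0, g, hgk, -, hf, ⟨l, c, t, hgl, hq, hs⟩ | ⟨-, hgl, hq, hs⟩⟩
  · rw [h1.2, sub_self, LaurentTate.coeff_zero, tn_zero]
    exact h00
  · rw [hq, Pi.add_apply, add_sub_cancel_left]
    by_cases hl : j = l
    · subst hl
      rw [Pi.single_eq_same]
      refine tn_term_le ?_ u
      rw [le_div_iff₀ hg, ← gauss_term_mul, ← hgl]
      exact fst_le_of_mk_le ω (hgk (lm ω g))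
    · rw [Pi.single_eq_of_ne hl, LaurentTate.coeff_zero, tn_zero]
      exact h00
  · rw [hq, sub_self, LaurentTate.coeff_zero, tn_zero]
    exact h00

theorem remainder_increment_le (ω : GMO C) (hne : ∀ j, h j ≠ 0) {a b : DivState K r m}
    (hab : DivStep ω h a b) (u : Fin n → ℤ) :
    tn r ((b.s - a.s).coeff u) u ≤ gauss ω a.f := by
  have h00 : 0 ≤ gauss ω a.f := tn_nonneg r _ _
  rcases divStep_cases ω hne hab with h1 |
    ⟨h0, g, hgk, -, hf, ⟨l, c, t, hgl, hq, hs⟩ | ⟨-, hgl, hq, hs⟩⟩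
  · rw [h1.2, sub_self, LaurentTate.coeff_zero, tn_zero]
    exact h00
  · rw [hs, sub_self, LaurentTate.coeff_zero, tn_zero]
    exact h00
  · rw [hs, add_sub_cancel_left]
    exact tn_term_le le_rfl u

/-- Division always has an output. -/
theorem exists_isRem (hK : IsDiscretelyValued K) (ω : GMO C) (hne : ∀ j, h j ≠ 0)
    (f : LaurentTate K r) : ∃ s, IsRem ω h f s := by
  choose next hnext using exists_divStep (h := h) ω
  let σ : ℕ → DivState K r m := fun k => Nat.rec ⟨f, 0, 0⟩ (fun _ a => next a) k
  have hσ : ∀ k, DivStep ω h (σ k) (σ (k + 1)) := fun k => hnext (σ k)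
  have hq : ∀ j, ∃ q, ConvergesTo (fun k => (σ k).q j) q := by
    intro j
    refine exists_convergesTo fun ε hε => ?_
    have hg := gauss_pos ω (hne j)
    obtain ⟨N, hN⟩ := tendsto_dividend hK ω hne hσ (mul_pos hε hg)
    exact ⟨N, fun k hk u => (quotient_increment_le ω hne (hσ k) j u).trans
      ((div_le_iff₀ hg).2 (hN k hk))⟩
  have hs : ∃ s, ConvergesTo (fun k => (σ k).s) s := by
    refine exists_convergesTo fun ε hε => ?_
    obtain ⟨N, hN⟩ := tendsto_dividend hK ω hne hσ hε
    exact ⟨N, fun k hk u => (remainder_increment_le ω hne (hσ k) u).trans (hN k hk)⟩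
  choose q hq using hq
  obtain ⟨s, hs⟩ := hs
  exact ⟨s, q, σ, rfl, rfl, rfl, hσ, hq, hs⟩

/-- The remainders of an element of an ideal by a Gröbner basis are zero. -/
theorem isRem_eq_zero (ω : GMO C) (hne : ∀ j, h j ≠ 0) {J : Ideal (LaurentTate K r)}
    (hJ : ∀ j, h j ∈ J) (hred : ∀ f ∈ J, f ≠ 0 → ∃ (i : I) (j : Fin m), Reducible ω f (h j) i)
    {f s : LaurentTate K r} (hf : f ∈ J) (hs : IsRem ω h f s) : s = 0 := by
  obtain ⟨q, σ, h1, -, h3, hσ, -, hlim⟩ := hs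
  have key : ∀ k, (σ k).f ∈ J ∧ (σ k).s = 0 := by
    intro k
    induction k with
    | zero => exact ⟨h1 ▸ hf, h3⟩
    | succ k ih =>
      rcases divStep_cases ω hne (hσ k) with h1 |
        ⟨h0, g, -, -, hf, ⟨l, c, t, hgl, -, hs⟩ | ⟨hn, -, -, -⟩⟩
      · rw [h1.2]
        exact ih
      · rw [hf, hs, hgl]
        exact ⟨J.sub_mem ih.1 (J.mul_mem_left _ (hJ l)), ih.2⟩
      · exact absurd (hred _ ih.1 h0) hn
  have : (fun k => (σ k).s) = fun _ => 0 := funext fun k => (key k).2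
  rw [this] at hlim
  exact hlim.unique (ConvergesTo.const 0)

/-- A vanishing remainder yields a representation with controlled terms. -/
theorem exists_standard_representation (hK : IsDiscretelyValued K) (ω : GMO C)
    (hne : ∀ j, h j ≠ 0) {f : LaurentTate K r} (hf : IsRem ω h f 0) {b : ℝ} {v : Fin n → ℤ}
    (hb : 0 < b) (hκ : ∀ w, key ω f w < mk ω b v) :
    ∃ q : Fin m → LaurentTate K r, f = ∑ j, q j * h j ∧
      ∀ j u w, key ω (LaurentTate.term r ((q j).coeff u) u * h j) w < mk ω b v := by
  obtain ⟨q, σ, h1, h2, h3, hσ, hq, hs⟩ := hf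
  refine ⟨q, ?_, fun j u w => ?_⟩
  · have hinv : ∀ k, (σ k).f + ∑ j, (σ k).q j * h j + (σ k).s = f := by
      intro k
      induction k with
      | zero => simp [h1, h2, h3]
      | succ k ih => rw [divStep_invariant ω hne (hσ k), ih]
    have hlim := ((convergesTo_dividend hK ω hne hσ).add
      (ConvergesTo.sum Finset.univ fun j _ => (hq j).mul_right (h j))).add hs
    simp only [hinv, zero_add, add_zero] at hlim
    exact (ConvergesTo.const f).unique hlim
  · have hfk : ∀ k w, key ω (σ k).f w < mk ω b v := by
      intro k
      induction k with
      | zero => rwa [h1]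
      | succ k ih =>
        intro w
        by_cases h0 : (σ k).f = 0
        · rcases divStep_cases ω hne (hσ k) with h1 | h1
          · rw [h1.2]
            exact ih w
          · exact absurd h0 h1.1
        · exact (key_divStep_lt ω hne (hσ k) h0 w).trans (ih _)
    have hqk : ∀ k w, key ω (LaurentTate.term r (((σ k).q j).coeff u) u * h j) w < mk ω b v := by
      intro k
      induction k with
      | zero =>
        intro w
        rw [h2, Pi.zero_apply, LaurentTate.coeff_zero, term_zero, zero_mul]
        exact key_zero_lt ω hb v w
      | succ k ih =>
        intro w
        rcases divStep_cases ω hne (hσ k) with h1 |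
          ⟨h0, g, hg, -, -, ⟨l, c, t, hgl, hq, -⟩ | ⟨-, -, hq, -⟩⟩
        · rw [h1.2]
          exact ih w
        · rw [hq, Pi.add_apply]
          -- A monomial of a quotient may be hit by several steps; the ultrametric inequality keeps
          -- the accumulated coefficient below the bound.
          by_cases hc : j = l ∧ u = t
          · obtain ⟨rfl, rfl⟩ := hc
            rw [Pi.single_eq_same, LaurentTate.coeff_add, LaurentTate.coeff_term,
              Pi.single_eq_same, add_term, add_mul, ← hgl]
            exact (key_add_le ω _ _ w).trans_lt
              (max_lt (ih w) ((hg w).trans_lt (hfk k _)))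
          · have e : ((Pi.single l (LaurentTate.term r c t) : Fin m → LaurentTate K r) j).coeff u
                = 0 := by
              by_cases hjl : j = l
              · subst hjl
                rw [Pi.single_eq_same, LaurentTate.coeff_term,
                  Pi.single_eq_of_ne fun hut => hc ⟨rfl, hut⟩]
              · rw [Pi.single_eq_of_ne hjl, LaurentTate.coeff_zero]
            rw [LaurentTate.coeff_add, e, add_zero]
            exact ih w
        · rw [hq]
          exact ih w
    have hg := gauss_pos ω (hne j)
    -- A strict bound could be lost in the limit. With this `N` the tail contributes absolute values
    -- at most `b / 2`, hence strictly below `b`.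
    obtain ⟨N, hN⟩ := convergesTo_iff.1 (hq j) (b / 2 / gauss ω (h j)) (by positivity)
    have hN := hN N le_rfl u
    rw [le_div_iff₀ hg] at hN
    have e : (q j).coeff u = ((σ N).q j).coeff u + -((σ N).q j - q j).coeff u := by
      rw [LaurentTate.coeff_sub]; ring
    rw [e, add_term, add_mul]
    refine (key_add_le ω _ _ w).trans_lt (max_lt (hqk N w) ?_)
    rw [key, mk_lt_mk]
    refine Or.inl ((tn_le_gauss ω _ w).trans_lt ?_)
    rw [gauss_term_mul, tn_neg]
    linarith

end Division

/-! ### Buchberger's criterion -/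

section Buchberger

variable {K : Type*} [NormedField K] [IsUltrametricDist K] {n : ℕ}
  {r : Fin n → ℚ} {I : Type*} [Finite I] {C : ConicDecomposition n I}

theorem lci_ne_zero' (ω : GMO C) (i : I) {f : LaurentTate K r} (hf : f ≠ 0) :
    lci ω i f ≠ 0 := by
  obtain ⟨t, ht⟩ := coneSet_nonempty ω i hf
  exact lci_ne_zero ω hf (lm_term_sub_lmi ω hf ⟨t, ht, rfl⟩)

theorem coeff_term_lmi_mul (ω : GMO C) (i : I) (a : K) (f : LaurentTate K r)
    (v : Fin n → ℤ) :
    (LaurentTate.term r a (v - lmi ω i f) * f).coeff v = a * lci ω i f := by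
  rw [LaurentTate.coeff_term_mul, sub_sub_cancel, lci]

variable {m : ℕ} {h : Fin m → LaurentTate K r}

/-- `q` is a family of multipliers of `h` whose terms are below `(B, v)`, with absolute values
relative to `B` that preserve the set `E`. -/
def IsSmall (ω : GMO C) (h : Fin m → LaurentTate K r) (E : Set ℝ) (B : ℝ) (v : Fin n → ℤ)
    (q : Fin m → LaurentTate K r) : Prop :=
  ∀ l u, (q l).coeff u ≠ 0 →
    (∀ w, key ω (LaurentTate.term r ((q l).coeff u) u * h l) w < mk ω B v) ∧
    ∀ x ∈ E, x * (tn r ((q l).coeff u) u * (gauss ω (h l) * B⁻¹)) ∈ E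

/-- Both the multipliers and the reference value `B` are scaled by `tn r a t`, so relative values do
not change. The strict bounds on keys survive because `v` and `t` share a cone. -/
theorem IsSmall.shift {ω : GMO C} {E : Set ℝ} {B : ℝ} {v t : Fin n → ℤ} {i : I}
    (hv : v ∈ C.cone i) (ht : t ∈ C.cone i) {a : K} (ha : a ≠ 0) {q : Fin m → LaurentTate K r}
    (hq : IsSmall ω h E B v q) :
    IsSmall ω h E (tn r a t * B) (v + t) fun l => LaurentTate.term r a t * q l := by
  intro l u hu
  simp only [LaurentTate.coeff_term_mul] at hu ⊢
  obtain ⟨h1, h2⟩ := hq l (u - t) (right_ne_zero_of_mul hu)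
  refine ⟨fun w => ?_, fun x hx => ?_⟩
  · have := key_term_mul_lt ω ha ht hv (h1 (w - t))
    rwa [term_mul_term_mul, sub_add_cancel, add_sub_cancel] at this
  · have hp := ((tn_pos_iff r (u := t)).2 ha).ne'
    have e : tn r (a * (q l).coeff (u - t)) u = tn r a t * tn r ((q l).coeff (u - t)) (u - t) := by
      rw [← tn_mul, add_sub_cancel]
    rw [e]
    convert h2 x hx using 1
    rw [mul_inv]
    field_simp

/-- The terms of `p * g` are below `κ`, with absolute values in `E`. -/
def IsAdm (ω : GMO C) (E : Set ℝ) (κ : ℝ ×ₗ Mon ω) (g p : LaurentTate K r) : Prop :=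
  ∀ u, p.coeff u ≠ 0 → tn r (p.coeff u) u * gauss ω g ∈ E ∧
    ∀ w, key ω (LaurentTate.term r (p.coeff u) u * g) w < κ

theorem IsSmall.isAdm {ω : GMO C} {E : Set ℝ} {B : ℝ} (hB : B ∈ E) (hB0 : B ≠ 0)
    {v : Fin n → ℤ} {q : Fin m → LaurentTate K r} (hq : IsSmall ω h E B v q) (l : Fin m) :
    IsAdm ω E (mk ω B v) (h l) (q l) := by
  intro u hu
  obtain ⟨h1, h2⟩ := hq l u hu
  refine ⟨?_, h1⟩
  convert h2 B hB using 1
  field_simp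

variable [CompleteSpace K]

theorem coeff_sum {ι : Type*} (s : Finset ι) (f : ι → LaurentTate K r) (u : Fin n → ℤ) :
    (∑ i ∈ s, f i).coeff u = ∑ i ∈ s, (f i).coeff u := by
  classical
  induction s using Finset.induction_on with
  | empty => simp
  | insert a s ha ih => rw [Finset.sum_insert ha, Finset.sum_insert ha, LaurentTate.coeff_add, ih]

theorem key_sum_lt (ω : GMO C) {ι : Type*} (s : Finset ι) {f : ι → LaurentTate K r} {b : ℝ}
    {v : Fin n → ℤ} (hb : 0 < b) {w : Fin n → ℤ} (hf : ∀ i ∈ s, key ω (f i) w < mk ω b v) :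
    key ω (∑ i ∈ s, f i) w < mk ω b v := by
  classical
  induction s using Finset.induction_on with
  | empty => exact key_zero_lt ω hb v w
  | insert a s ha ih =>
    rw [Finset.sum_insert ha]
    exact (key_add_le ω _ _ w).trans_lt (max_lt (hf a (Finset.mem_insert_self a s))
      (ih fun i hi => hf i (Finset.mem_insert_of_mem hi)))

/-- The two leading terms of an S-pair cancel. -/
theorem key_sPair_lt (ω : GMO C) {i : I} {f g : LaurentTate K r} (hf : f ≠ 0) (hg : g ≠ 0)
    {v : Fin n → ℤ} (hvf : v ∈ leadSet ω i f) (hvg : v ∈ leadSet ω i g) (w : Fin n → ℤ) :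
    key ω (sPair ω i f g v) w < mk ω (tn r (lci ω i f * lci ω i g) v) v := by
  have hlf := lci_ne_zero' ω i hf
  have hlg := lci_ne_zero' ω i hg
  have hle : ∀ {a : K} {p : LaurentTate K r}, a ≠ 0 → p ≠ 0 → v ∈ leadSet ω i p → ∀ w,
      key ω (LaurentTate.term r a (v - lmi ω i p) * p) w ≤ mk ω (tn r (a * lci ω i p) v) v := by
    intro a p ha hp hv w
    refine (key_le_leadKey ω (term_mul_ne_zero ha _ hp) w).trans_eq ?_
    rw [leadKey, lm_term_mul_smul ω ha, lm_term_sub_lmi ω hp hv, key, coeff_term_lmi_mul]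
  have h1 := hle hlg hf hvf
  rw [mul_comm (lci ω i g)] at h1
  refine key_sub_lt (v := v) ω h1 (hle hlf hg hvg) ?_ ?_ ?_ w
  · rw [key, coeff_term_lmi_mul, mul_comm]
  · rw [coeff_term_lmi_mul, coeff_term_lmi_mul, mul_comm]
  · rw [coeff_term_lmi_mul]
    exact mul_ne_zero hlg hlf

/-- This reduces S-pairs at arbitrary common leading monomials to the finitely many generators. -/
theorem sPair_add (ω : GMO C) (i : I) (f g : LaurentTate K r) (v t : Fin n → ℤ) :
    sPair ω i f g (v + t) = LaurentTate.term r 1 t * sPair ω i f g v := by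
  rw [sPair, sPair, mul_sub, term_mul_term_mul, term_mul_term_mul, one_mul, one_mul]
  congr 4 <;> abel

theorem IsAdm.key_lt {ω : GMO C} {E : Set ℝ} {b : ℝ} (hb : 0 < b) {v : Fin n → ℤ}
    {g p : LaurentTate K r} (hp : IsAdm ω E (mk ω b v) g p) (u w : Fin n → ℤ) :
    key ω (LaurentTate.term r (p.coeff u) u * g) w < mk ω b v := by
  by_cases h0 : p.coeff u = 0
  · rw [h0, term_zero, zero_mul]
    exact key_zero_lt ω hb v w
  · exact (hp u h0).2 w

/-- Coefficients of the sum may cancel partially; closure of `E` under `π` accounts for it. -/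
theorem IsAdm.add {ω : GMO C} {π : ℝ} (hπ : IsUniformizerNorm K π) {E : Set ℝ}
    (hE : ∀ x ∈ E, x * π ∈ E) {b : ℝ} (hb : 0 < b) {v : Fin n → ℤ}
    {g p q : LaurentTate K r} (hp : IsAdm ω E (mk ω b v) g p) (hq : IsAdm ω E (mk ω b v) g q) :
    IsAdm ω E (mk ω b v) g (p + q) := by
  intro u hu
  rw [LaurentTate.coeff_add] at hu ⊢
  refine ⟨tn_add_mem r hπ hE (fun h => (hp u h).1) (fun h => (hq u h).1) hu, fun w => ?_⟩
  rw [add_term, add_mul]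
  exact (key_add_le ω _ _ w).trans_lt (max_lt (hp.key_lt hb u w) (hq.key_lt hb u w))

theorem IsAdm.sum {ω : GMO C} {π : ℝ} (hπ : IsUniformizerNorm K π) {E : Set ℝ}
    (hE : ∀ x ∈ E, x * π ∈ E) {b : ℝ} (hb : 0 < b) {v : Fin n → ℤ}
    {g : LaurentTate K r} {ι : Type*} (s : Finset ι) {p : ι → LaurentTate K r}
    (hp : ∀ i ∈ s, IsAdm ω E (mk ω b v) g (p i)) : IsAdm ω E (mk ω b v) g (∑ i ∈ s, p i) := by
  classical
  induction s using Finset.induction_on with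
  | empty => exact fun u hu => absurd rfl hu
  | insert a s ha ih =>
    rw [Finset.sum_insert ha]
    exact (hp a (Finset.mem_insert_self a s)).add hπ hE hb
      (ih fun i hi => hp i (Finset.mem_insert_of_mem hi))

theorem IsAdm.key_mul_lt {ω : GMO C} {E : Set ℝ} {b : ℝ} (hb : 0 < b) {v : Fin n → ℤ}
    {g p : LaurentTate K r} (hp : IsAdm ω E (mk ω b v) g p) (w : Fin n → ℤ) :
    key ω (p * g) w < mk ω b v := by
  obtain ⟨u, hu⟩ := exists_key_mul_le ω p g w
  exact hu.trans_lt (hp.key_lt hb u w)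

theorem coeff_sub_term_self (p : LaurentTate K r) {u w : Fin n → ℤ}
    (hu : (p - LaurentTate.term r (p.coeff w) w).coeff u ≠ 0) :
    u ≠ w ∧ (p - LaurentTate.term r (p.coeff w) w).coeff u = p.coeff u := by
  rw [LaurentTate.coeff_sub, LaurentTate.coeff_term] at hu ⊢
  have huw : u ≠ w := by
    rintro rfl
    rw [Pi.single_eq_same, sub_self] at hu
    exact hu rfl
  rw [Pi.single_eq_of_ne huw, sub_zero]
  exact ⟨huw, rfl⟩

/-- If the largest terms of a representation exceed `f`, then they can be rewritten through the
S-pairs. -/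
theorem exists_lower_representation {ω : GMO C} (hne : ∀ j, h j ≠ 0) {π : ℝ}
    (hπ : IsUniformizerNorm K π) {E : Set ℝ} (hE : ∀ x ∈ E, x * π ∈ E) {b : ℝ} (hb : 0 < b)
    {v : Fin n → ℤ} {i : I} (hv : v ∈ C.cone i)
    (hpair : ∀ j k, h j ≠ h k → v ∈ leadSet ω i (h j) → v ∈ leadSet ω i (h k) →
      ∃ q : Fin m → LaurentTate K r, sPair ω i (h j) (h k) v = ∑ l, q l * h l ∧
        IsSmall ω h E (tn r (lci ω i (h j) * lci ω i (h k)) v) v q)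
    {f : LaurentTate K r} (hf : ∀ w, key ω f w < mk ω b v) {p : Fin m → LaurentTate K r}
    (hfp : f = ∑ j, p j * h j)
    (hpE : ∀ j u, (p j).coeff u ≠ 0 → tn r ((p j).coeff u) u * gauss ω (h j) ∈ E)
    (hple : ∀ j u w, key ω (LaurentTate.term r ((p j).coeff u) u * h j) w ≤ mk ω b v)
    (hpmax : ∃ j u w, key ω (LaurentTate.term r ((p j).coeff u) u * h j) w = mk ω b v) :
    ∃ p' : Fin m → LaurentTate K r, f = ∑ j, p' j * h j ∧
      ∀ j, IsAdm ω E (mk ω b v) (h j) (p' j) := by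
  classical
  -- Since `v` lies in the cone `i`, this is the only exponent at which a term of `p j`, multiplied
  -- by `h j`, can reach `(b, v)`.
  let e : Fin m → Fin n → ℤ := fun j => v - lmi ω i (h j)
  let c : Fin m → K := fun j => (p j).coeff (e j)
  let τ : Fin m → LaurentTate K r := fun j => LaurentTate.term r (c j) (e j)
  let A : Finset (Fin m) := Finset.univ.filter fun j => key ω (τ j * h j) v = mk ω b v
  -- a product reaching `(b, v)` is one of the `τ j * h j`
  have hreach : ∀ j u w, key ω (LaurentTate.term r ((p j).coeff u) u * h j) w = mk ω b v →
      u = e j ∧ j ∈ A ∧ v ∈ leadSet ω i (h j) := by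
    intro j u w hw
    obtain ⟨hbw, rfl⟩ := mk_injective ω hw
    have h0 : (LaurentTate.term r ((p j).coeff u) u * h j).coeff w ≠ 0 :=
      (tn_pos_iff r).1 (hbw ▸ hb)
    have hc : (p j).coeff u ≠ 0 := by
      rw [LaurentTate.coeff_term_mul] at h0
      exact left_ne_zero_of_mul h0
    have hlm := lm_eq_of_key_eq ω (hple j u) hw h0
    rw [lm_term_mul_smul ω hc] at hlm
    have hu : u = e j := by
      have := eq_sub_lmi ω (i := i) (hne j) (t := u) (by rw [hlm]; exact hv)
      rwa [hlm] at this
    refine ⟨hu, Finset.mem_filter.2 ⟨Finset.mem_univ _, ?_⟩,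
      (mem_leadSet_iff ω (hne j)).2 ⟨hv, u, hlm⟩⟩
    rw [hu] at hw
    exact hw
  have hA : ∀ j ∈ A, v ∈ leadSet ω i (h j) ∧ tn r (c j * lci ω i (h j)) v = b := by
    intro j hj
    have hj := (Finset.mem_filter.1 hj).2
    refine ⟨(hreach j (e j) v hj).2.2, ?_⟩
    rw [key, coeff_term_lmi_mul] at hj
    exact (mk_injective ω hj).1
  obtain ⟨j₀, u₀, w₀, hw₀⟩ := hpmax
  obtain ⟨-, hj₀, hvj₀⟩ := hreach j₀ u₀ w₀ hw₀
  have hl₀ := lci_ne_zero' ω i (hne j₀)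
  have hc0 : ∀ j ∈ A, c j ≠ 0 := fun j hj =>
    left_ne_zero_of_mul ((tn_pos_iff r).1 ((hA j hj).2 ▸ hb))
  have hg₀ : tn r (lci ω i (h j₀)) (lmi ω i (h j₀)) = gauss ω (h j₀) :=
    tn_lci ω (lm_term_sub_lmi ω (hne j₀) hvj₀)
  have htn₀ : ∀ a, tn r a (e j₀) * gauss ω (h j₀) = tn r (a * lci ω i (h j₀)) v := by
    intro a
    rw [← hg₀, ← tn_mul, sub_add_cancel]
  have hbE : b ∈ E := by
    have := hpE j₀ (e j₀) (hc0 j₀ hj₀)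
    rwa [htn₀, (hA j₀ hj₀).2] at this
  -- the part of the representation that does not reach `(b, v)`
  let p₁ : Fin m → LaurentTate K r := fun j => if j ∈ A then p j - τ j else p j
  have hp₁ : ∀ j, IsAdm ω E (mk ω b v) (h j) (p₁ j) := by
    intro j u hu
    have hcoeff : (p₁ j).coeff u = (p j).coeff u ∧ ¬(u = e j ∧ j ∈ A) := by
      by_cases hj : j ∈ A
      · simp only [p₁, if_pos hj] at hu ⊢
        exact ⟨(coeff_sub_term_self _ hu).2, fun h => (coeff_sub_term_self _ hu).1 h.1⟩
      · exact ⟨by simp only [p₁, if_neg hj], fun h => hj h.2⟩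
    rw [hcoeff.1] at hu ⊢
    exact ⟨hpE j u hu, fun w => lt_of_le_of_ne (hple j u w) fun hw =>
      hcoeff.2 ⟨(hreach j u w hw).1, (hreach j u w hw).2.1⟩⟩
  have hsplit : f = ∑ j, p₁ j * h j + ∑ j ∈ A, τ j * h j := by
    rw [hfp, ← Finset.sum_filter_add_sum_filter_not Finset.univ (fun j => j ∈ A)
      (fun j => p₁ j * h j), ← Finset.sum_filter_add_sum_filter_not Finset.univ (fun j => j ∈ A)
      (fun j => p j * h j), Finset.filter_mem_eq_inter, Finset.univ_inter]
    have e1 : ∑ j ∈ A, p₁ j * h j = ∑ j ∈ A, p j * h j - ∑ j ∈ A, τ j * h j := by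
      rw [← Finset.sum_sub_distrib]
      refine Finset.sum_congr rfl fun j hj => ?_
      simp only [p₁, if_pos hj, sub_mul]
    have e2 : ∑ j ∈ Finset.univ.filter (fun j => j ∉ A), p₁ j * h j =
        ∑ j ∈ Finset.univ.filter (fun j => j ∉ A), p j * h j := by
      refine Finset.sum_congr rfl fun j hj => ?_
      simp only [p₁, if_neg (Finset.mem_filter.1 hj).2]
    rw [e1, e2]
    abel
  -- the leading coefficients cancel
  let s : K := ∑ j ∈ A, c j * lci ω i (h j)
  have hs : tn r s v < b := by
    have hlt : key ω (∑ j ∈ A, τ j * h j) v < mk ω b v := by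
      -- The sum of the `τ j * h j` is `f` minus the lower part, and both are strictly below `(b,
      -- v)`.
      rw [← sub_eq_iff_eq_add'.2 hsplit]
      exact (key_sub_le ω _ _ v).trans_lt (max_lt (hf v)
        (key_sum_lt ω _ hb fun j _ => (hp₁ j).key_mul_lt hb v))
    have hcoeff : (∑ j ∈ A, τ j * h j).coeff v = s := by
      rw [coeff_sum]
      exact Finset.sum_congr rfl fun j _ => coeff_term_lmi_mul ω i (c j) (h j) v
    rw [key, hcoeff, mk_lt_mk] at hlt
    exact hlt.resolve_right fun h => lt_irrefl _ h.2
  -- With `j₀` as pivot, each `τ j * h j` is a scalar multiple of its S-pair with `h j₀` plus a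
  -- multiple of the single product at `j₀`. When `h j = h j₀` no S-pair is needed.
  have hq : ∀ j, ∃ q : Fin m → LaurentTate K r, j ∈ A →
      (τ j * h j = ∑ l, q l * h l +
        LaurentTate.term r (c j * lci ω i (h j) / lci ω i (h j₀)) (e j₀) * h j₀) ∧
      IsSmall ω h E b v q := by
    intro j
    by_cases hj : j ∈ A
    swap
    · exact ⟨0, fun h => absurd h hj⟩
    by_cases hjj : h j = h j₀
    · refine ⟨0, fun _ => ⟨?_, fun l u hu => absurd rfl hu⟩⟩
      simp only [Pi.zero_apply, zero_mul, Finset.sum_const_zero, zero_add, τ, e, hjj]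
      rw [mul_div_cancel_right₀ _ hl₀]
    · obtain ⟨q, hq1, hq2⟩ := hpair j j₀ hjj (hA j hj).1 hvj₀
      refine ⟨fun l => LaurentTate.term r (c j / lci ω i (h j₀)) 0 * q l, fun _ => ⟨?_, ?_⟩⟩
      · have e1 : ∑ l, LaurentTate.term r (c j / lci ω i (h j₀)) 0 * q l * h l =
            LaurentTate.term r (c j / lci ω i (h j₀)) 0 * sPair ω i (h j) (h j₀) v := by
          rw [hq1, Finset.mul_sum]
          exact Finset.sum_congr rfl fun l _ => mul_assoc _ _ _
        rw [e1, sPair, mul_sub, term_mul_term_mul, term_mul_term_mul, zero_add, zero_add,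
          div_mul_cancel₀ _ hl₀, div_mul_eq_mul_div, sub_add_cancel]
      · have := hq2.shift hv (zero_mem _) (div_ne_zero (hc0 j hj) hl₀)
        rw [← tn_mul, zero_add, add_zero] at this
        convert this using 1
        rw [← (hA j hj).2]
        congr 1
        field_simp
  choose q hq using hq
  -- The multiples of `h j₀` left over by all `j ∈ A` add up to this term. Its value is that of `s`,
  -- which is below `b ∈ E`, so discreteness puts it in `E`.
  let ρ : LaurentTate K r := LaurentTate.term r (s / lci ω i (h j₀)) (e j₀)
  have hρ : IsAdm ω E (mk ω b v) (h j₀) ρ := by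
    intro u hu
    by_cases hue : u = e j₀
    swap
    · rw [LaurentTate.coeff_term, Pi.single_eq_of_ne hue] at hu
      exact absurd rfl hu
    have hρu : ρ.coeff u = s / lci ω i (h j₀) := by
      rw [hue, LaurentTate.coeff_term, Pi.single_eq_same]
    rw [hρu] at hu ⊢
    have htn : tn r (s / lci ω i (h j₀)) u * gauss ω (h j₀) = tn r s v := by
      rw [hue, htn₀, div_mul_cancel₀ _ hl₀]
    refine ⟨?_, fun w => (mk_lt_mk ω).2 (Or.inl ((tn_le_gauss ω _ w).trans_lt ?_))⟩
    · rw [htn, ← mul_one (tn r s v)]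
      have hs0 : s ≠ 0 := by
        rintro h0
        rw [h0, zero_div] at hu
        exact hu rfl
      refine tn_mem_of_le r hπ hE hs0 (b := c j₀ * lci ω i (h j₀)) ?_ ?_
      · rw [← tn_le_tn_iff r (u := v), (hA j₀ hj₀).2]
        exact hs.le
      · rwa [(hA j₀ hj₀).2, mul_one]
    · rw [gauss_term_mul, htn]
      exact hs
  refine ⟨fun l => p₁ l + ∑ j ∈ A, q j l + if l = j₀ then ρ else 0, ?_, fun l => ?_⟩
  · have e1 : ∑ j ∈ A, τ j * h j = ∑ l, (∑ j ∈ A, q j l) * h l + ρ * h j₀ := by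
      rw [Finset.sum_congr rfl fun j hj => (hq j hj).1, Finset.sum_add_distrib, Finset.sum_comm]
      congr 1
      · exact Finset.sum_congr rfl fun l _ => (Finset.sum_mul _ _ _).symm
      · rw [← Finset.sum_mul]
        congr 1
        ext u
        rw [coeff_sum]
        simp only [ρ, LaurentTate.coeff_term, s]
        by_cases hu : u = e j₀
        · subst hu
          simp only [Pi.single_eq_same, Finset.sum_div]
        · simp only [Pi.single_eq_of_ne hu, Finset.sum_const_zero]
    rw [hsplit, e1]
    simp only [add_mul, Finset.sum_add_distrib, ite_mul, zero_mul, Finset.sum_ite_eq',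
      Finset.mem_univ, if_true]
    abel
  · refine ((hp₁ l).add hπ hE hb (IsAdm.sum hπ hE hb A fun j hj =>
      (hq j hj).2.isAdm hbE hb.ne' l)).add hπ hE hb ?_
    by_cases hl : l = j₀
    · rw [if_pos hl, hl]
      exact hρ
    · rw [if_neg hl]
      exact fun u hu => absurd rfl hu

/-- The products of the terms of the `p j` with `h j` have a largest leading key. -/
theorem exists_max_term (ω : GMO C) (hne : ∀ j, h j ≠ 0) {p : Fin m → LaurentTate K r}
    (hp : ∑ j, p j * h j ≠ 0) :
    ∃ j₀ u₀, (p j₀).coeff u₀ ≠ 0 ∧ ∀ j u w,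
      key ω (LaurentTate.term r ((p j).coeff u) u * h j) w ≤
        leadKey ω (LaurentTate.term r ((p j₀).coeff u₀) u₀ * h j₀) := by
  obtain ⟨j₁, hj₁⟩ : ∃ j, p j ≠ 0 := by
    by_contra! h0
    exact hp (Finset.sum_eq_zero fun j _ => by rw [h0 j, zero_mul])
  obtain ⟨u₁, hu₁⟩ := exists_coeff_ne_zero hj₁
  let T : Fin m × (Fin n → ℤ) → LaurentTate K r :=
    fun x => LaurentTate.term r ((p x.1).coeff x.2) x.2 * h x.1
  have hb : 0 < gauss ω (T (j₁, u₁)) := gauss_pos ω (term_mul_ne_zero hu₁ _ (hne j₁))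
  have hfin : {x | gauss ω (T (j₁, u₁)) ≤ gauss ω (T x)}.Finite := by
    refine (Set.finite_iUnion fun j => (finite_le_tn (p j)
      (div_pos hb (gauss_pos ω (hne j)))).image fun u => (j, u)).subset ?_
    rintro ⟨j, u⟩ hx
    rw [Set.mem_ofPred_eq, gauss_term_mul ω _ u] at hx
    exact Set.mem_iUnion.2 ⟨j, u, (div_le_iff₀ (gauss_pos ω (hne j))).2 hx, rfl⟩
  obtain ⟨⟨j₀, u₀⟩, h₀, hmax⟩ := Set.exists_max_image _ (fun x => leadKey ω (T x)) hfin
    ⟨(j₁, u₁), le_refl (gauss ω (T (j₁, u₁)))⟩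
  have hpos : 0 < gauss ω (T (j₀, u₀)) := hb.trans_le h₀
  refine ⟨j₀, u₀, fun h0 => ?_, fun j u w => ?_⟩
  · rw [gauss_term_mul, h0, tn_zero, zero_mul] at hpos
    exact lt_irrefl _ hpos
  · by_cases hx : gauss ω (T (j₁, u₁)) ≤ gauss ω (T (j, u))
    · have hTne : T (j, u) ≠ 0 := by
        intro h0
        rw [h0, gauss_zero] at hx
        linarith
      exact (key_le_leadKey ω hTne w).trans (hmax (j, u) hx)
    · refine ((mk_lt_mk ω).2 (Or.inl ?_)).le
      exact (tn_le_gauss ω (T (j, u)) w).trans_lt ((not_le.1 hx).trans_le h₀)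

end Buchberger

/-! ### Minimal representations and the leading monomials of the ideal. -/

section Criterion

variable {K : Type*} [NormedField K] [IsUltrametricDist K] [CompleteSpace K] {n : ℕ}
  {r : Fin n → ℚ} {I : Type*} [Finite I] {C : ConicDecomposition n I} {m : ℕ}
  {h : Fin m → LaurentTate K r}

/-- If the S-pairs have standard representations, then the leading monomials of the ideal are
those of the sets `leadSet`. -/
theorem exists_lm_mem_leadSet (hK : IsDiscretelyValued K) {ω : GMO C} (hne : ∀ j, h j ≠ 0)
    {U : I → Fin m → Fin m → Finset (Fin n → ℤ)}
    (hU : ∀ i j k, h j ≠ h k → Generates C i (U i j k)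
      (leadSet ω i (h j) ∩ leadSet ω i (h k)))
    (hS : ∀ i j k, h j ≠ h k → ∀ v ∈ U i j k, IsRem ω h (sPair ω i (h j) (h k) v) 0)
    {f : LaurentTate K r} (hf : f ∈ Ideal.span (Set.range h)) (hf0 : f ≠ 0) :
    ∃ j i, lm ω f ∈ leadSet ω i (h j) := by
  obtain ⟨π, hπ⟩ : ∃ π, IsUniformizerNorm K π := exists_uniformizer_norm hK
  have hg : ∀ j, 0 < gauss ω (h j) := fun j => gauss_pos ω (hne j)
  let B : I → Fin m → Fin m → (Fin n → ℤ) → ℝ := fun i j k v =>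
    tn r (lci ω i (h j) * lci ω i (h k)) v
  have hB : ∀ i j k v, 0 < B i j k v := fun i j k v =>
    (tn_pos_iff r).2 (mul_ne_zero (lci_ne_zero' ω i (hne j)) (lci_ne_zero' ω i (hne k)))
  have hUmem : ∀ i j k, h j ≠ h k → ∀ v ∈ U i j k,
      v ∈ leadSet ω i (h j) ∧ v ∈ leadSet ω i (h k) := by
    intro i j k hjk v hv
    have : v ∈ leadSet ω i (h j) ∩ leadSet ω i (h k) := by
      rw [hU i j k hjk]
      exact ⟨0, zero_mem _, v, hv, (zero_add v).symm⟩
    exact this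
  -- Pairs with `h j = h k` receive `q = 0`, so that the choice is total in `j` and `k`.
  have hq : ∀ i j k (v : U i j k), ∃ q : Fin m → LaurentTate K r,
      (h j ≠ h k → sPair ω i (h j) (h k) v = ∑ l, q l * h l) ∧ ∀ l u w,
        key ω (LaurentTate.term r ((q l).coeff u) u * h l) w < mk ω (B i j k v) v := by
    rintro i j k ⟨v, hv⟩
    by_cases hjk : h j = h k
    · refine ⟨0, fun h => absurd hjk h, fun l u w => ?_⟩
      rw [Pi.zero_apply, LaurentTate.coeff_zero, term_zero, zero_mul]
      exact key_zero_lt ω (hB i j k v) v w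
    · obtain ⟨hvj, hvk⟩ := hUmem i j k hjk v hv
      obtain ⟨q, hq1, hq2⟩ := exists_standard_representation hK ω hne (hS i j k hjk v hv)
        (hB i j k v) (key_sPair_lt ω (hne j) (hne k) hvj hvk)
      exact ⟨q, fun _ => hq1, hq2⟩
  choose q hqS hqlt using hq
  -- These are the factors a rewriting through S-pairs can introduce. They are at most one because
  -- the quotients lie below the cancelled leading terms, and locally finite because there are
  -- finitely many generators.
  let S : Set ℝ := insert π (⋃ i, ⋃ j, ⋃ k, ⋃ v : U i j k, ⋃ l,
    {x | ∃ u, (q i j k v l).coeff u ≠ 0 ∧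
      x = tn r ((q i j k v l).coeff u) u * (gauss ω (h l) * (B i j k v)⁻¹)})
  have hSfin : LocFin S := by
    refine LocFin.insert (LocFin.iUnion fun i => LocFin.iUnion fun j => LocFin.iUnion fun k =>
      LocFin.iUnion fun v => LocFin.iUnion fun l => locFin_tn _ ?_) π
    exact mul_pos (hg l) (inv_pos.2 (hB i j k v))
  have hqmem : ∀ i j k v l u, (q i j k v l).coeff u ≠ 0 →
      tn r ((q i j k v l).coeff u) u * (gauss ω (h l) * (B i j k v)⁻¹) ∈ S := by
    intro i j k v l u hu
    refine Set.mem_insert_of_mem _ ?_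
    simp only [Set.mem_iUnion]
    exact ⟨i, j, k, v, l, u, hu, rfl⟩
  have hS' : ∀ s ∈ S, 0 < s ∧ s ≤ 1 := by
    rintro s (rfl | hs)
    · exact ⟨hπ.1, hπ.2.1.le⟩
    · simp only [Set.mem_iUnion] at hs
      obtain ⟨i, j, k, v, l, u, hu, rfl⟩ := hs
      refine ⟨mul_pos ((tn_pos_iff r).2 hu) (mul_pos (hg l) (inv_pos.2 (hB i j k v))), ?_⟩
      rw [← mul_assoc, ← div_eq_mul_inv, div_le_one (hB i j k v), ← gauss_term_mul]
      exact fst_le_of_mk_le ω (hqlt i j k v l u _).le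
  obtain ⟨p₀, hp₀⟩ := (Submodule.mem_span_range_iff_exists_fun _).1 hf
  simp only [smul_eq_mul] at hp₀
  obtain ⟨E, hE₀, hEfin, hES⟩ := exists_locFin_closed
    (LocFin.iUnion fun j => locFin_tn (p₀ j) (hg j))
    (by
      intro x hx
      obtain ⟨j, u, hu, rfl⟩ := Set.mem_iUnion.1 hx
      exact mul_pos ((tn_pos_iff r).2 hu) (hg j))
    hSfin (fun s hs => (hS' s hs).1) (fun s hs => (hS' s hs).2)
  have hEπ : ∀ x ∈ E, x * π ∈ E := fun x hx => hES x hx π (Set.mem_insert _ _)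
  -- a representation with values in `E` whose largest key is minimal
  let V : (Fin m → LaurentTate K r) → Prop := fun p => f = ∑ j, p j * h j ∧
    ∀ j u, (p j).coeff u ≠ 0 → tn r ((p j).coeff u) u * gauss ω (h j) ∈ E
  let M : (Fin m → LaurentTate K r) → ℝ ×ₗ Mon ω → Prop := fun p κ =>
    (∀ j u w, key ω (LaurentTate.term r ((p j).coeff u) u * h j) w ≤ κ) ∧
    ∃ j u, (p j).coeff u ≠ 0 ∧ κ = leadKey ω (LaurentTate.term r ((p j).coeff u) u * h j)
  -- The largest key of any representation dominates the leading key of `f`; this provides the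
  -- positive lower bound that well-foundedness requires.
  have hle : ∀ p : Fin m → LaurentTate K r, f = ∑ j, p j * h j → ∀ κ,
      (∀ j u w, key ω (LaurentTate.term r ((p j).coeff u) u * h j) w ≤ κ) →
      leadKey ω f ≤ κ := by
    intro p hp κ hκ
    by_contra hlt
    rw [not_le, leadKey_eq] at hlt
    have : key ω f (lm ω f) < mk ω (gauss ω f) (lm ω f) := by
      nth_rewrite 1 [hp]
      refine key_sum_lt ω _ (gauss_pos ω hf0) fun j _ => ?_
      obtain ⟨u, hu⟩ := exists_key_mul_le ω (p j) (h j) (lm ω f)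
      exact hu.trans_lt ((hκ j u _).trans_lt hlt)
    exact lt_irrefl _ this
  have hM : ∀ p, V p → ∃ κ, M p κ ∧ (ofLex κ).1 ∈ E ∧ gauss ω f ≤ (ofLex κ).1 := by
    rintro p ⟨hp, hpE⟩
    obtain ⟨j₀, u₀, h0, hmax⟩ := exists_max_term ω hne (p := p) (hp ▸ hf0)
    refine ⟨_, ⟨hmax, j₀, u₀, h0, rfl⟩, ?_, fst_le_of_mk_le ω (hle p hp _ hmax)⟩
    change gauss ω (LaurentTate.term r ((p j₀).coeff u₀) u₀ * h j₀) ∈ E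
    rw [gauss_term_mul]
    exact hpE j₀ u₀ h0
  have hV₀ : V p₀ := ⟨hp₀.symm, fun j u hu => hE₀ (Set.mem_iUnion.2 ⟨j, u, hu, rfl⟩)⟩
  obtain ⟨κ₀, hκ₀, hκ₀'⟩ := hM p₀ hV₀
  obtain ⟨⟨κ, hκE⟩, ⟨p, hVp, hMp⟩, hmin⟩ := (wellFounded_lex hEfin (gauss_pos ω hf0) ω).has_min
    {κ | ∃ p, V p ∧ M p κ.1} ⟨⟨κ₀, hκ₀'⟩, p₀, hV₀, hκ₀⟩
  obtain ⟨hMle, j₀, u₀, h0, hκ⟩ := hMp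
  simp only at hMle hκ
  set T := LaurentTate.term r ((p j₀).coeff u₀) u₀ * h j₀ with hT
  have hlmT : lm ω T = lm ω (LaurentTate.term r 1 u₀ * h j₀) := lm_term_mul_smul ω h0 u₀ (h j₀)
  -- The cone is dictated by the monomial to be eliminated; only S-pairs for this `i` are used.
  obtain ⟨i, hi⟩ := C.cover (lm ω T)
  rcases (hle p hVp.1 κ hMle).eq_or_lt with heq | hlt
  · refine ⟨j₀, i, (mem_leadSet_iff ω (hne j₀)).2 ?_⟩
    rw [hκ] at heq
    rw [(mk_injective ω heq).2]
    exact ⟨hi, u₀, hlmT.symm⟩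
  · exfalso
    rw [leadKey_eq ω T] at hκ
    have hTpos : 0 < gauss ω T := gauss_pos ω (term_mul_ne_zero h0 u₀ (hne j₀))
    obtain ⟨p', hp', hadm⟩ := exists_lower_representation hne hπ hEπ hTpos hi
      (by
        intro j k hjk hvj hvk
        have hv : lm ω T ∈ leadSet ω i (h j) ∩ leadSet ω i (h k) := ⟨hvj, hvk⟩
        rw [hU i j k hjk] at hv
        -- The S-pair at `lm ω T` is the `X^t`-multiple of the one at a generator `v`, so the chosen
        -- quotients, shifted by `t`, represent it.
        obtain ⟨t, ht, v, hvU, e⟩ := hv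
        have hvc := ((mem_leadSet_iff ω (hne j)).1 (hUmem i j k hjk v hvU).1).1
        refine ⟨fun l => LaurentTate.term r 1 t * q i j k ⟨v, hvU⟩ l, ?_, ?_⟩
        · rw [e, add_comm, sPair_add, hqS i j k ⟨v, hvU⟩ hjk, Finset.mul_sum]
          exact Finset.sum_congr rfl fun l _ => (mul_assoc _ _ _).symm
        · have hsm : IsSmall ω h E (B i j k v) v (q i j k ⟨v, hvU⟩) := fun l u hu =>
            ⟨hqlt i j k ⟨v, hvU⟩ l u, fun x hx => hES x hx _ (hqmem i j k ⟨v, hvU⟩ l u hu)⟩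
          have := hsm.shift hvc ht (one_ne_zero : (1 : K) ≠ 0)
          rw [← tn_mul, one_mul, ← e, add_comm v, ← e] at this
          exact this)
      (fun w => (key_le_leadKey ω hf0 w).trans_lt (hκ ▸ hlt)) hVp.1 hVp.2
      (fun j u w => hκ ▸ hMle j u w) ⟨j₀, u₀, lm ω T, rfl⟩
    have hVp' : V p' := ⟨hp', fun j u hu => (hadm j u hu).1⟩
    obtain ⟨κ', hM', hκ'E⟩ := hM p' hVp'
    refine hmin ⟨κ', hκ'E⟩ ⟨p', hVp', hM'⟩ ?_
    obtain ⟨-, j, u, hu, rfl⟩ := hM'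
    exact ((hadm j u hu).2 _).trans_eq hκ.symm

end Criterion

end

end LaurentGB

/-! ### The equivalence of the three conditions. -/

open LaurentGB

theorem mainTheorem2 {K : Type*} [NormedField K] [IsUltrametricDist K] [CompleteSpace K]
    (hK : LaurentGB.IsDiscretelyValued K) {n : ℕ} (hn : 0 < n) (r : Fin n → ℚ)
    {I : Type*} [Finite I] (C : LaurentGB.ConicDecomposition n I) (ω : LaurentGB.GMO C)
    {m : ℕ} (h : Fin m → LaurentGB.LaurentTate K r) (hne : ∀ j, h j ≠ 0)
    (U : I → Fin m → Fin m → Finset (Fin n → ℤ))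
    (hU : ∀ i j k, h j ≠ h k → LaurentGB.Generates C i (U i j k)
      (LaurentGB.leadSet ω i (h j) ∩ LaurentGB.leadSet ω i (h k))) :
    List.TFAE
      [LaurentGB.IsGroebnerBasis ω (Ideal.span (Set.range h)) (Set.range h),
       ∀ i j k, h j ≠ h k → ∀ v ∈ U i j k, ∀ s,
         LaurentGB.IsRem ω h (LaurentGB.sPair ω i (h j) (h k) v) s → s = 0,
       ∀ i j k, h j ≠ h k → ∀ v ∈ U i j k,
         LaurentGB.IsRem ω h (LaurentGB.sPair ω i (h j) (h k) v) 0] := by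
  have hmem : ∀ j, h j ∈ Ideal.span (Set.range h) := fun j => Ideal.subset_span ⟨j, rfl⟩
  tfae_have 1 → 2 := by
    rintro ⟨-, -, hlm⟩ i j k hjk v hv s hs
    refine isRem_eq_zero ω hne hmem (fun f hf hf0 => ?_) ?_ hs
    · obtain ⟨_, ⟨l, rfl⟩, i', hi'⟩ := hlm.subset ⟨f, hf, hf0, rfl⟩
      exact ⟨i', l, reducible_of_mem_leadSet ω (hne l) hi'⟩
    · exact Ideal.sub_mem _ (Ideal.mul_mem_left _ _ (hmem j)) (Ideal.mul_mem_left _ _ (hmem k))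
  tfae_have 2 → 3 := by
    intro h2 i j k hjk v hv
    obtain ⟨s, hs⟩ := exists_isRem hK ω hne (sPair ω i (h j) (h k) v)
    rwa [h2 i j k hjk v hv s hs] at hs
  tfae_have 3 → 1 := by
    intro h3
    refine ⟨Set.finite_range h, ?_, Set.Subset.antisymm ?_ ?_⟩
    · rintro _ ⟨j, rfl⟩
      exact ⟨hmem j, hne j⟩
    · rintro _ ⟨f, hf, hf0, rfl⟩
      obtain ⟨j, i, hij⟩ := exists_lm_mem_leadSet hK hne hU h3 hf hf0
      exact ⟨h j, ⟨j, rfl⟩, i, hij⟩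
    -- This inclusion does not depend on the S-pairs: such a `u` is the leading monomial of a
    -- monomial multiple of `h j`.
    · rintro u ⟨_, ⟨j, rfl⟩, i, hu⟩
      obtain ⟨-, t, rfl⟩ := (mem_leadSet_iff ω (hne j)).1 hu
      exact ⟨_, Ideal.mul_mem_left _ _ (hmem j), term_mul_ne_zero one_ne_zero t (hne j), rfl⟩
  tfae_finish
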